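/- Let $\mathbb F$ be an algebraically closed field of characteristic $p>0$. For a dominant weight $\lambda=(\lambda_1\ge\dots\ge\lambda_n)\in\mathbb Z^n$ let $L_n(\lambda)$ be the simple rational $GL_n(\mathbb F)$-module of highest weight $\lambda$ (with respect to the diagonal torus and the upper triangular Borel subgroup), and for $\mu\in\mathbb Z^n$ let $L_n(\lambda)_\mu$ be its $\mu$-weight space, on which $\mathrm{diag}(t_1,\dots,t_n)$ acts as $t_1^{\mu_1}\cdots t_n^{\mu_n}$. Write $\epsilon_a$ for the $a$-th standard basis vector of $\mathbb Z^n$, $\alpha_r=\epsilon_r-\epsilon_{r+1}$ and $\alpha(a,b)=\sum_{r=a}^{b-1}\alpha_r$. For $1\le i<j\le n$ define square integer matrices $X_u^{i,j}(k)$, $Y_u^{i,j}(k)$ of size $2^{j-1-u}$, for $i\le u<j$ and $i\le k<j$, by descending recursion on $u$: $X_{j-1}^{i,j}(k)=\lambda_k-\lambda_j$, $Y_{j-1}^{i,j}(k)=-(\lambda_k-\lambda_j)$, and for $i\le u<j-1$, with $u^*=j-1-u+i$, $$X_u^{i,j}(k)=\begin{pmatrix} X_{u+1}^{i,j}(k)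 & Y_{u+1}^{i,j}(u^*)\\ X_{u+1}^{i,j}(k)+Y_{u+1}^{i,j}(u^*) & (\lambda_{u^*}-\lambda_j)\bigl(X_{u+1}^{i,j}(k)+Y_{u+1}^{i,j}(u^*)\bigr)\end{pmatrix},$$ $$Y_u^{i,j}(k)=\begin{pmatrix} Y_{u+1}^{i,j}(k) & -Y_{u+1}^{i,j}(k)\\ 0 & -(\lambda_k-\lambda_j)\bigl(X_{u+1}^{i,j}(i)+Y_{u+1}^{i,j}(u^*)\bigr)\end{pmatrix}.$$ Suppose that $\lambda\neq 0$ is dominant with last nonzero entry $\lambda_s$ (so $\lambda_{s+1}=\dots=\lambda_n=0$), where $s<n-1$. For $1\le i\le s-1$ put $X=X_{i+1}^{i,s+1}(i)$, $Y=Y_{i+1}^{i,s+1}(s)$, $$M^i=\begin{pmatrix}\lambda_sX & Y & (\lambda_s-1)Y\\ Y & \lambda_sX & (\lambda_s-1)Y\\ \lambda_s(X+Y) & \lambda_s(X+Y) & \lambda_s(\lambda_s-1)(X+Y)\end{pmatrix},\qquad W^i=\begin{pmatrix}\lambda_sX+Y & (\lambda_s-1)Y\\ \lambda_s(X+Y)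 & \tfrac12\lambda_s(\lambda_s-1)(X+Y)\end{pmatrix}.$$ Then, where $\operatorname{rank}_p$ denotes the rank of an integer matrix reduced modulo $p$: 1. $\dim L_n(\lambda)_{\lambda-\alpha(i,j)}=\operatorname{rank}_p X_i^{i,j}(i)$ for all $1\le i<j\le n$; 2. $\dim L_n(\lambda)_{\lambda-\alpha(i,s+1)-\alpha(s,s+2)}=\operatorname{rank}_p M^i$ for all $1\le i\le s-1$; 3. $\dim L_n(\lambda)_{\lambda-\alpha(i,s+1)-\alpha(s,s+1)}=\operatorname{rank}_p W^i$ for all $1\le i\le s-1$. -/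

import Mathlib

namespace GLWeights

/-! ### Rational modules for the general linear group and their weight spaces -/

section Modules

variable {n : ℕ} {F : Type*} [Field F]

/-- Regular functions on `GL_n(F)`: quotients of polynomials in the matrix entries by powers of
the determinant. (For an infinite field these are the elements of the coordinate ring.) -/
def IsRegularFunction (f : Matrix.GeneralLinearGroup (Fin n) F → F) : Prop :=
  ∃ (P : MvPolynomial (Fin n × Fin n) F) (m : ℕ), ∀ g : Matrix.GeneralLinearGroup (Fin n) F,
    f g * (g : Matrix (Fin n) (Fin n) F).det ^ m =
      MvPolynomial.eval (fun ij => (g : Matrix (Fin n) (Fin n) F) ij.1 ij.2) P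

/-- A rational representation of `GL_n(F)`: the action on each vector is given by finitely many
regular functions, i.e. `v ↦ (g ↦ g v)` takes values in `V ⊗ F[GL_n]`. -/
def IsRational {V : Type*} [AddCommGroup V] [Module F V]
    (ρ : Representation F (Matrix.GeneralLinearGroup (Fin n) F) V) : Prop :=
  ∀ v : V, ∃ (r : ℕ) (f : Fin r → Matrix.GeneralLinearGroup (Fin n) F → F) (w : Fin r → V),
    (∀ k, IsRegularFunction (f k)) ∧ ∀ g, ρ g v = ∑ k, f k g • w k

/-- The diagonal matrix `diag(t_1, …, t_n)` as an element of `GL_n(F)`. -/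
def torus (t : Fin n → Fˣ) : Matrix.GeneralLinearGroup (Fin n) F where
  val := Matrix.diagonal fun a => (t a : F)
  inv := Matrix.diagonal fun a => ((t a)⁻¹ : Fˣ)
  val_inv := by simp
  inv_val := by simp

/-- The weight space `V_μ`: all `v` with `diag(t) v = t_1 ^ μ_1 ⋯ t_n ^ μ_n v` for all `t`. -/
def weightSpace {V : Type*} [AddCommGroup V] [Module F V]
    (ρ : Representation F (Matrix.GeneralLinearGroup (Fin n) F) V) (μ : Fin n → ℤ) :
    Submodule F V where
  carrier := {v | ∀ t : Fin n → Fˣ, ρ (torus t) v = ((∏ a, t a ^ μ a : Fˣ) : F) • v}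
  add_mem' := fun hv hw t => by rw [map_add, hv t, hw t, smul_add]
  zero_mem' := fun t => by rw [map_zero, smul_zero]
  smul_mem' := fun c v hv t => by rw [map_smul, hv t, smul_comm]

end Modules

/-! ### Roots and the dominance order (entries are numbered `1, …, n`) -/

/-- `ε_a`, the tuple with a `1` in the `a`-th entry and `0` elsewhere. -/
def epsilon (n a : ℕ) : Fin n → ℤ := fun b => if (b : ℕ) + 1 = a then 1 else 0

/-- The simple root `α_r = ε_r - ε_{r+1}`. -/
def simpleRoot (n r : ℕ) : Fin n → ℤ := epsilon n r - epsilon n (r + 1)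

/-- `α(a,b) = α_a + α_{a+1} + ⋯ + α_{b-1}`. -/
def alpha (n a b : ℕ) : Fin n → ℤ := ∑ r ∈ Finset.Ico a b, simpleRoot n r

/-- `μ ≤ lam` in the dominance order: `lam - μ` is a sum of simple roots. -/
def Subdominant {n : ℕ} (μ lam : Fin n → ℤ) : Prop :=
  lam - μ ∈ AddSubmonoid.closure {β | ∃ r : ℕ, 1 ≤ r ∧ r < n ∧ β = simpleRoot n r}

/-- `ρ` is (a model of) the simple module `L_n(lam)`: a simple rational module of highest
weight `lam`, i.e. `lam` is a weight and all weights are subdominant to `lam`. -/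
structure IsSimpleOfHighestWeight {n : ℕ} {F : Type*} [Field F] {V : Type*} [AddCommGroup V]
    [Module F V] (ρ : Representation F (Matrix.GeneralLinearGroup (Fin n) F) V)
    (lam : Fin n → ℤ) : Prop where
  rational : IsRational ρ
  simple : ρ.IsIrreducible
  weight : weightSpace ρ lam ≠ ⊥
  highest : ∀ μ : Fin n → ℤ, weightSpace ρ μ ≠ ⊥ → Subdominant μ lam

/-- The `a`-th entry `lam_a` of the tuple `(lam_1, …, lam_n)`, where `1 ≤ a ≤ n`. -/
def entry {n : ℕ} (lam : Fin n → ℤ) (a : ℕ) : ℤ :=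
  if h : 1 ≤ a ∧ a ≤ n then lam ⟨a - 1, by omega⟩ else 0

/-! ### The recursive matrices -/

/-- Index set of the `2 ^ d` by `2 ^ d` matrices. -/
def Idx : ℕ → Type
  | 0 => Unit
  | d + 1 => Idx d ⊕ Idx d

/-- `Idx d` is finite. -/
instance Idx.instFintype : (d : ℕ) → Fintype (Idx d)
  | 0 => inferInstanceAs (Fintype Unit)
  | d + 1 => letI := Idx.instFintype d; inferInstanceAs (Fintype (Idx d ⊕ Idx d))

/-- The functions `k ↦ X_u^{i,j}(k)` and `k ↦ Y_u^{i,j}(k)` for `u = j - 1 - d`, by recursion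
on `d`; in the step from `u + 1 = j - 1 - d` to `u = j - 1 - (d + 1)` one has
`u^* = j - 1 - u + i = i + d + 1`. -/
def matXY {n : ℕ} (lam : Fin n → ℤ) (i j : ℕ) :
    (d : ℕ) → (ℕ → Matrix (Idx d) (Idx d) ℤ) × (ℕ → Matrix (Idx d) (Idx d) ℤ)
  | 0 =>
    (fun k => Matrix.of fun _ _ => entry lam k - entry lam j,
     fun k => Matrix.of fun _ _ => -(entry lam k - entry lam j))
  | d + 1 =>
    let X := (matXY lam i j d).1
    let Y := (matXY lam i j d).2
    let u' := i + d + 1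
    (fun k => Matrix.fromBlocks
        (X k)         (Y u')
        (X k + Y u')  ((entry lam u' - entry lam j) • (X k + Y u')),
     fun k => Matrix.fromBlocks
        (Y k)  (-Y k)
        0      ((-(entry lam k - entry lam j)) • (X i + Y u')))

/-- The matrix `X_u^{i,j}(k)`, for `i ≤ u < j` and `i ≤ k < j`. -/
def matX {n : ℕ} (lam : Fin n → ℤ) (i j u k : ℕ) :
    Matrix (Idx (j - 1 - u)) (Idx (j - 1 - u)) ℤ :=
  (matXY lam i j (j - 1 - u)).1 k

/-- The matrix `Y_u^{i,j}(k)`, for `i ≤ u < j` and `i ≤ k < j`. -/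
def matY {n : ℕ} (lam : Fin n → ℤ) (i j u k : ℕ) :
    Matrix (Idx (j - 1 - u)) (Idx (j - 1 - u)) ℤ :=
  (matXY lam i j (j - 1 - u)).2 k

/-- The block matrix `M^i`, with `X = X_{i+1}^{i,s+1}(i)` and `Y = Y_{i+1}^{i,s+1}(s)`. -/
def matM {n : ℕ} (lam : Fin n → ℤ) (s i : ℕ) :
    Matrix (Fin 3 × Idx (s + 1 - 1 - (i + 1))) (Fin 3 × Idx (s + 1 - 1 - (i + 1))) ℤ :=
  let X := matX lam i (s + 1) (i + 1) i
  let Y := matY lam i (s + 1) (i + 1) s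
  let l := entry lam s
  Matrix.comp _ _ _ _ _
    !![l • X,       Y,           (l - 1) • Y;
       Y,           l • X,       (l - 1) • Y;
       l • (X + Y), l • (X + Y), (l * (l - 1)) • (X + Y)]

/-- The block matrix `W^i`, with `X = X_{i+1}^{i,s+1}(i)` and `Y = Y_{i+1}^{i,s+1}(s)`; the
integer division by `2` is exact. -/
def matW {n : ℕ} (lam : Fin n → ℤ) (s i : ℕ) :
    Matrix (Fin 2 × Idx (s + 1 - 1 - (i + 1))) (Fin 2 × Idx (s + 1 - 1 - (i + 1))) ℤ :=
  let X := matX lam i (s + 1) (i + 1) i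
  let Y := matY lam i (s + 1) (i + 1) s
  let l := entry lam s
  Matrix.comp _ _ _ _ _
    !![l • X + Y,   (l - 1) • Y;
       l • (X + Y), (l * (l - 1) / 2) • (X + Y)]

/-- The rank of the reduction modulo `p` of a square integer matrix. -/
noncomputable def modRank (p : ℕ) {ι : Type*} [Fintype ι] (A : Matrix ι ι ℤ) : ℕ :=
  (A.map (Int.cast : ℤ → ZMod p)).rank

end GLWeights

/-! Fix a highest weight vector `v` and a functional `φ` with `φ v = 1` that vanishes on every
weight space except that of `lam`. Each dimension is the rank of a Gram matrix `φ (X_A (Y_B v))`,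
where the `Y_B` are monomials in lowering operators, the `X_A` are monomials in raising operators,
and all of them have the same weight `β`.

The operators are the divided powers `E_ab^(k)`, the coefficients of `t ^ k` in the action of `1 + t
E_ab`. Products lower · torus · upper are dense in `GL_n`. Upper root subgroups and the torus act
trivially or by scalars on `v`, so simplicity makes the lowering monomials applied to `v` span `V`
(`span_monomial_eq_top`). Dually, lower root subgroups fix `φ`, so a weight vector `w` is zero once
`φ (X w) = 0` for all raising monomials `X` of the right weight (`eq_zero_of_functional`). Since
`lam` is constant after position `s`, Weyl symmetry makes root subgroups with both indices beyond
`s` fix `v` and `φ`, so only roots starting at or before `s` are needed. These facts combine in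
`finrank_eq_modRank`.

It remains to list the monomials and pair them. For `β = α(i,j)` they are chains `i → a₁ → ⋯ → j`
(`Monomial.chain`), and commuting one link across a pairing gives a recursion on the largest
intermediate point (`pairing`). This is the recursion of the theorem: `X(i)` is the Gram matrix with
endpoint value `λ_j`, and `Y(k)` is its change when `λ_j` is replaced by `λ_k` (`matXY_eq_gram`).

For the other two weights the monomials are a chain from `i` times steps out of `s`: three families
for `M` (`Monomial.chain_mul`) and two for `W` (`Monomial.chain_mul_square`). Their pairings reduce
to the Gram matrices above and to `SL_2` computations (`dividedPower_dividedPower_apply`). The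
entries are integers, so the rank over `F` is the rank modulo `p`. -/

namespace GLWeights

open Finset

/-! ### Vector-valued polynomial functions and their coefficients. -/

section Coefficients

variable {F V W : Type*} [Field F] [AddCommGroup V] [Module F V] [AddCommGroup W] [Module F W]

/-- The function `g` is the polynomial function `t ↦ ∑ t ^ k c_k`. -/
def HasCoeff (g : F → V) (c : ℕ → V) : Prop :=
  ∃ N, (∀ k, N ≤ k → c k = 0) ∧ ∀ t, g t = ∑ k ∈ range N, t ^ k • c k

namespace HasCoeff

theorem exists_bound {g : F → V} {c : ℕ → V} (h : HasCoeff g c) :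
    ∃ N, ∀ M, N ≤ M → (∀ k, M ≤ k → c k = 0) ∧ ∀ t, g t = ∑ k ∈ range M, t ^ k • c k := by
  obtain ⟨N, hN, hg⟩ := h
  refine ⟨N, fun M hM => ⟨fun k hk => hN k (hM.trans hk), fun t => ?_⟩⟩
  rw [hg t]
  refine sum_subset (range_mono hM) fun k _ hk => ?_
  rw [hN k (by simpa using hk), smul_zero]

theorem add {g g' : F → V} {c c' : ℕ → V} (h : HasCoeff g c) (h' : HasCoeff g' c') :
    HasCoeff (fun t => g t + g' t) (fun k => c k + c' k) := by
  obtain ⟨N, hN⟩ := h.exists_bound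
  obtain ⟨N', hN'⟩ := h'.exists_bound
  obtain ⟨h1, h2⟩ := hN (max N N') (le_max_left _ _)
  obtain ⟨h1', h2'⟩ := hN' (max N N') (le_max_right _ _)
  exact ⟨max N N', fun k hk => by simp [h1 k hk, h1' k hk], fun t => by
    beta_reduce
    rw [h2, h2', ← sum_add_distrib]; simp⟩

theorem zero : HasCoeff (fun _ : F => (0 : V)) (fun _ => 0) := ⟨0, by simp⟩

theorem sum {ι : Type*} (s : Finset ι) {g : ι → F → V} {c : ι → ℕ → V}
    (h : ∀ i ∈ s, HasCoeff (g i) (c i)) :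
    HasCoeff (fun t => ∑ i ∈ s, g i t) (fun k => ∑ i ∈ s, c i k) := by
  classical
  induction s using Finset.induction_on with
  | empty => simpa using zero
  | insert a s ha ih =>
    simp only [sum_insert ha]
    exact (h a (mem_insert_self _ _)).add (ih fun i hi => h i (mem_insert_of_mem hi))

theorem map {g : F → V} {c : ℕ → V} (h : HasCoeff g c) (L : V →ₗ[F] W) :
    HasCoeff (fun t => L (g t)) (fun k => L (c k)) := by
  obtain ⟨N, hN, hg⟩ := h
  exact ⟨N, fun k hk => by simp [hN k hk], fun t => by simp [hg]⟩

theorem const (v : V) : HasCoeff (fun _ : F => v) (fun k => if k = 0 then v else 0) :=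
  ⟨1, fun k hk => if_neg (by omega), by simp⟩

theorem scale {g : F → V} {c : ℕ → V} (h : HasCoeff g c) (s : F) :
    HasCoeff (fun t => g (s * t)) (fun k => s ^ k • c k) := by
  obtain ⟨N, hN, hg⟩ := h
  exact ⟨N, fun k hk => by simp [hN k hk], fun t => by
    simp only [hg, mul_pow, mul_smul]
    exact sum_congr rfl fun k _ => smul_comm _ _ _⟩

theorem shift {g : F → V} {c : ℕ → V} (h : HasCoeff g c) (m : ℕ) :
    HasCoeff (fun t => t ^ m • g t) (fun k => if m ≤ k then c (k - m) else 0) := by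
  obtain ⟨N, hN, hg⟩ := h
  refine ⟨m + N, fun k hk => ?_, fun t => ?_⟩
  · beta_reduce
    split_ifs
    · exact hN _ (by omega)
    · rfl
  · rw [sum_range_add, sum_eq_zero (s := range m), zero_add]
    · beta_reduce
      rw [hg, smul_sum]
      exact sum_congr rfl fun k _ => by simp [pow_add, mul_smul]
    · intro k hk
      beta_reduce
      rw [if_neg (by simpa using hk), smul_zero]

theorem of_polynomial (P : Polynomial F) (v : V) :
    HasCoeff (fun t => P.eval t • v) (fun k => P.coeff k • v) :=
  ⟨P.natDegree + 1, fun k hk => by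
    beta_reduce
    rw [Polynomial.coeff_eq_zero_of_natDegree_lt (by omega), zero_smul], fun t => by
    beta_reduce
    rw [Polynomial.eval_eq_sum_range, sum_smul]
    exact sum_congr rfl fun k _ => by rw [mul_comm, mul_smul]⟩

/-- Composition of a polynomial family of operators with a polynomial function. -/
theorem comp {A : F → V →ₗ[F] W} {a : ℕ → V →ₗ[F] W}
    (hA : ∀ v, HasCoeff (fun t => A t v) (fun k => a k v))
    {g : F → V} {c : ℕ → V} (h : HasCoeff g c) :
    HasCoeff (fun t => A t (g t)) (fun m => ∑ k ∈ range (m + 1), a (m - k) (c k)) := by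
  obtain ⟨N, hN, hg⟩ := h
  have h1 := sum (range N) (fun k _ => (hA (c k)).shift k)
  have h2 : (fun t => A t (g t)) = fun t => ∑ k ∈ range N, t ^ k • A t (c k) := by
    funext t; rw [hg]; simp
  rw [h2]
  convert h1 using 2 with m
  rw [sum_ite, sum_const_zero, add_zero]
  rw [← sum_subset (s₁ := (range N).filter (· ≤ m)) (s₂ := range (m + 1))]
  · intro k hk
    simp at hk ⊢; omega
  · intro k hk hk'
    simp at hk hk'
    rw [hN k (by by_contra hlt; have := hk' (by omega); omega), map_zero]

variable [Infinite F]

/-- Testing against linear functionals reduces this to a scalar polynomial vanishing on an infinite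
field. -/
theorem unique_zero {c : ℕ → V} (h : HasCoeff (fun _ : F => (0 : V)) c) : c = 0 := by
  obtain ⟨N, hN, hg⟩ := h
  funext k
  rcases le_or_gt N k with hk | hk
  · exact hN k hk
  rw [Pi.zero_apply, ← Module.forall_dual_apply_eq_zero_iff F]
  intro ψ
  have h0 : (∑ k ∈ range N, Polynomial.monomial k (ψ (c k)) : Polynomial F) = 0 := by
    refine Polynomial.funext fun t => ?_
    have := congrArg ψ (hg t)
    rw [map_zero, map_sum] at this
    rw [Polynomial.eval_finsetSum, Polynomial.eval_zero, this]
    exact sum_congr rfl fun k _ => by simp [mul_comm]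
  have := congrArg (fun P => Polynomial.coeff P k) h0
  simpa [Polynomial.finsetSum_coeff, Polynomial.coeff_monomial, hk] using this

/-- This is what converts relations between root elements into relations between divided powers. -/
theorem unique {g : F → V} {c c' : ℕ → V} (h : HasCoeff g c) (h' : HasCoeff g c') : c = c' := by
  have h1 := h.add (h'.map (-LinearMap.id))
  simp only [LinearMap.neg_apply, LinearMap.id_apply, add_neg_cancel] at h1
  funext k
  have := congrFun h1.unique_zero k
  rwa [Pi.zero_apply, add_neg_eq_zero] at this

end HasCoeff

end Coefficients

/-! ### Root elements of the general linear group and their relations. -/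

section RootElements

variable {n : ℕ} {F : Type*} [Field F]

/-- The root element `1 + t E_{ab}` for `a ≠ b`, and `1` for `a = b`. -/
def rootElt (a b : Fin n) (t : F) : Matrix.GeneralLinearGroup (Fin n) F :=
  if h : a ≠ b then
    ⟨Matrix.transvection a b t, Matrix.transvection a b (-t),
      by rw [Matrix.transvection_mul_transvection_same _ _ h]; simp,
      by rw [Matrix.transvection_mul_transvection_same _ _ h]; simp⟩
  else 1

theorem coe_rootElt {a b : Fin n} (h : a ≠ b) (t : F) :
    (rootElt a b t : Matrix (Fin n) (Fin n) F) = 1 + Matrix.single a b t := by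
  simp [rootElt, h, Matrix.transvection]

@[simp] theorem rootElt_zero (a b : Fin n) : rootElt a b (0 : F) = 1 := by
  by_cases h : a ≠ b
  · apply Units.ext
    simp [coe_rootElt h]
  · simp [rootElt, h]

theorem rootElt_comm {a b c d : Fin n} (hbc : b ≠ c) (had : a ≠ d) (s t : F) :
    rootElt a b s * rootElt c d t = rootElt c d t * rootElt a b s := by
  by_cases h : a ≠ b
  · by_cases h' : c ≠ d
    · apply Units.ext
      rw [Units.val_mul, Units.val_mul, coe_rootElt h, coe_rootElt h']
      simp [mul_add, add_mul, hbc, had.symm]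
      abel
    · simp [rootElt, h']
  · simp [rootElt, h]

theorem rootElt_mul_rootElt {a b c : Fin n} (hab : a ≠ b) (hbc : b ≠ c) (hac : a ≠ c) (s t : F) :
    rootElt a b t * rootElt b c s = rootElt b c s * (rootElt a c (s * t) * rootElt a b t) := by
  apply Units.ext
  simp only [Units.val_mul, coe_rootElt hab, coe_rootElt hbc, coe_rootElt hac]
  simp [mul_add, add_mul, hac.symm, mul_comm s t]
  abel

theorem torus_mul_rootElt (a b : Fin n) (z : Fin n → Fˣ) (t : F) :
    torus z * rootElt a b t = rootElt a b ((z a / z b : Fˣ) * t) * torus z := by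
  by_cases h : a ≠ b
  · apply Units.ext
    simp only [Units.val_mul, coe_rootElt h, torus]
    rw [mul_add, add_mul, mul_one, one_mul]
    congr 1
    ext i j
    rw [Matrix.diagonal_mul, Matrix.mul_diagonal]
    by_cases hi : a = i
    · by_cases hj : b = j
      · subst hi hj
        simp [div_eq_mul_inv]
        field_simp
      · simp [Matrix.single, hi, hj]
    · simp [Matrix.single, hi]
  · simp [rootElt, h]

/-- The element of the torus with `u` in place `a` and `u⁻¹` in place `b`. -/
def coroot (a b : Fin n) (u : Fˣ) : Fin n → Fˣ := fun c => if c = a then u else if c = b then u⁻¹ else 1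

/-- The `SL_2` big cell: upper · lower becomes lower · torus · upper, which is possible exactly when
`1 + t * s` is invertible. -/
theorem rootElt_mul_rootElt_opp {a b : Fin n} (h : a ≠ b) (s t : F) (u : Fˣ)
    (hu : (u : F) = 1 + t * s) :
    rootElt a b t * rootElt b a s =
      rootElt b a (s / u) * torus (coroot a b u) * rootElt a b (t / u) := by
  apply Units.ext
  have hu0 : (1 + t * s) ≠ 0 := hu ▸ u.ne_zero
  simp only [Units.val_mul, coe_rootElt h, coe_rootElt h.symm, torus]
  ext i j
  simp only [mul_add, add_mul, Matrix.add_apply, mul_one, one_mul, Matrix.single_mul_single_same,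
    Matrix.mul_assoc]
  by_cases hia : i = a <;> by_cases hib : i = b <;> by_cases hja : j = a <;> by_cases hjb : j = b <;>
    simp_all [Matrix.single, Matrix.mul_apply, Matrix.diagonal, coroot, Matrix.one_apply, eq_comm]
  · have := Ne.symm hu0
    field_simp
  · have := Ne.symm hu0
    field_simp

end RootElements

/-! ### Divided power operators and their commutation rules. -/

section DividedPowers

variable {n : ℕ} {F : Type*} [Field F] {V : Type*} [AddCommGroup V] [Module F V]

/-- Root elements have determinant one, so the denominator disappears. -/
theorem IsRegularFunction.exists_polynomial_rootElt
    {f : Matrix.GeneralLinearGroup (Fin n) F → F} (hf : IsRegularFunction f) (a b : Fin n) :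
    ∃ P : Polynomial F, ∀ t, f (rootElt a b t) = P.eval t := by
  obtain ⟨P, m, hP⟩ := hf
  by_cases h : a ≠ b
  · refine ⟨MvPolynomial.eval₂ Polynomial.C (fun ij => Polynomial.C
      ((1 : Matrix (Fin n) (Fin n) F) ij.1 ij.2) +
      Polynomial.C ((Matrix.single a b (1 : F)) ij.1 ij.2) * Polynomial.X) P, fun t => ?_⟩
    have h1 := hP (rootElt a b t)
    have hdet : ((rootElt a b t : Matrix.GeneralLinearGroup (Fin n) F) :
        Matrix (Fin n) (Fin n) F).det = 1 := by
      rw [coe_rootElt h]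
      exact Matrix.det_transvection_of_ne a b h t
    rw [hdet, one_pow, mul_one] at h1
    rw [h1, ← Polynomial.coe_evalRingHom, MvPolynomial.hom_eval₂]
    have : (Polynomial.evalRingHom t).comp Polynomial.C = RingHom.id F := by ext; simp
    rw [this, ← MvPolynomial.eval₂_id]
    congr 1
    funext ij
    simp only [coe_rootElt h, Matrix.single_apply, Matrix.add_apply]
    split_ifs <;> simp
  · exact ⟨Polynomial.C (f 1), fun t => by simp [rootElt, h]⟩

variable (ρ : Representation F (Matrix.GeneralLinearGroup (Fin n) F) V)

theorem IsRational.exists_hasCoeff {ρ : Representation F (Matrix.GeneralLinearGroup (Fin n) F) V}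
    (hr : IsRational ρ) (a b : Fin n) (v : V) :
    ∃ c, HasCoeff (fun t => ρ (rootElt a b t) v) c := by
  obtain ⟨r, f, w, hf, hv⟩ := hr v
  choose P hP using fun k => (hf k).exists_polynomial_rootElt a b
  simp only [hv, hP]
  exact ⟨_, HasCoeff.sum univ fun k _ => HasCoeff.of_polynomial (P k) (w k)⟩

variable [Infinite F] {ρ}

/-- The divided power operator `E_{ab}^{(k)}`: the coefficient of `t ^ k` in the action of
`1 + t E_{ab}`. -/
noncomputable def dividedPower (hr : IsRational ρ) (a b : Fin n) (k : ℕ) : Module.End F V where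
  toFun v := (hr.exists_hasCoeff a b v).choose k
  map_add' v w := by
    have h := (hr.exists_hasCoeff a b v).choose_spec.add (hr.exists_hasCoeff a b w).choose_spec
    simp only [← map_add] at h
    exact congrFun ((hr.exists_hasCoeff a b (v + w)).choose_spec.unique h) k
  map_smul' r v := by
    have h := (hr.exists_hasCoeff a b v).choose_spec.map (r • LinearMap.id)
    simp only [LinearMap.smul_apply, LinearMap.id_apply, ← map_smul] at h
    exact congrFun ((hr.exists_hasCoeff a b (r • v)).choose_spec.unique h) k

variable (hr : IsRational ρ)

theorem hasCoeff_dividedPower (a b : Fin n) (v : V) :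
    HasCoeff (fun t => ρ (rootElt a b t) v) (fun k => dividedPower hr a b k v) :=
  (hr.exists_hasCoeff a b v).choose_spec

@[simp] theorem dividedPower_zero (a b : Fin n) : dividedPower hr a b 0 = 1 := by
  ext v
  obtain ⟨N, hN⟩ := (hasCoeff_dividedPower hr a b v).exists_bound
  have := (hN (N + 1) (by omega)).2 0
  rw [sum_range_succ'] at this
  simpa using this.symm

theorem dividedPower_comm {a b c d : Fin n} (hbc : b ≠ c) (had : a ≠ d) (k l : ℕ) :
    Commute (dividedPower hr a b k) (dividedPower hr c d l) := by
  -- The coefficient in the first parameter is extracted while the second factor is still a group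
  -- element; the second extraction follows.
  have key : ∀ s v, dividedPower hr a b k (ρ (rootElt c d s) v) =
      ρ (rootElt c d s) (dividedPower hr a b k v) := by
    intro s v
    have h1 := hasCoeff_dividedPower hr a b (ρ (rootElt c d s) v)
    have h2 := (hasCoeff_dividedPower hr a b v).map (ρ (rootElt c d s))
    simp only [← Module.End.mul_apply, ← map_mul, rootElt_comm hbc had] at h1 h2 ⊢
    exact congrFun (h1.unique h2) k
  ext v
  have h1 := (hasCoeff_dividedPower hr c d v).map (dividedPower hr a b k)
  have h2 := hasCoeff_dividedPower hr c d (dividedPower hr a b k v)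
  simp only [key] at h1
  exact congrFun (h1.unique h2) l

/-- Compare coefficients of `t ^ m * s ^ l` in `x_ab(t) x_bc(s) = x_bc(s) x_ac(st) x_ab(t)`. The
nested conditions select `i = m - k`, the power of `s` contributed by `x_ac`. -/
theorem sum_dividedPower_mul {a b c : Fin n} (hab : a ≠ b) (hbc : b ≠ c) (hac : a ≠ c)
    (m l : ℕ) (v : V) :
    dividedPower hr a b m (dividedPower hr b c l v) =
      ∑ i ∈ range (l + 1), dividedPower hr b c (l - i) (∑ k ∈ range (m + 1),
        if m - k ≤ i then (if i - (m - k) = 0 then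
          dividedPower hr a c (m - k) (dividedPower hr a b k v) else 0) else 0) := by
  have key : ∀ s, dividedPower hr a b m (ρ (rootElt b c s) v) =
      ρ (rootElt b c s) (∑ k ∈ range (m + 1),
        s ^ (m - k) • dividedPower hr a c (m - k) (dividedPower hr a b k v)) := by
    intro s
    have h1 := hasCoeff_dividedPower hr a b (ρ (rootElt b c s) v)
    have h2 := (HasCoeff.comp (A := fun t => ρ (rootElt a c (s * t)))
      (a := fun k => s ^ k • dividedPower hr a c k)
      (fun w => by
        simpa using (hasCoeff_dividedPower hr a c w).scale s)
      (hasCoeff_dividedPower hr a b v)).map (ρ (rootElt b c s))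
    simp only [← Module.End.mul_apply, ← map_mul, rootElt_mul_rootElt hab hbc hac] at h1 h2
    have := congrFun (h1.unique h2) m
    simpa using this
  have h1 := (hasCoeff_dividedPower hr b c v).map (dividedPower hr a b m)
  simp only [key] at h1
  have h2 := HasCoeff.comp (A := fun t => ρ (rootElt b c t))
    (a := fun k => dividedPower hr b c k) (hasCoeff_dividedPower hr b c)
    (HasCoeff.sum (range (m + 1)) fun k _ => (HasCoeff.const
      (dividedPower hr a c (m - k) (dividedPower hr a b k v))).shift (m - k))
  exact congrFun (h1.unique h2) l

theorem dividedPower_one_mul_one {a b c : Fin n} (hab : a ≠ b) (hbc : b ≠ c) (hac : a ≠ c) :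
    dividedPower hr a b 1 * dividedPower hr b c 1 =
      dividedPower hr b c 1 * dividedPower hr a b 1 + dividedPower hr a c 1 := by
  ext v
  have := sum_dividedPower_mul hr hab hbc hac 1 1 v
  simpa [sum_range_succ] using this

theorem dividedPower_two_mul_one {a b c : Fin n} (hab : a ≠ b) (hbc : b ≠ c) (hac : a ≠ c) :
    dividedPower hr a b 2 * dividedPower hr b c 1 =
      dividedPower hr b c 1 * dividedPower hr a b 2 +
        dividedPower hr a c 1 * dividedPower hr a b 1 := by
  ext v
  have := sum_dividedPower_mul hr hab hbc hac 2 1 v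
  simpa [sum_range_succ] using this

end DividedPowers

/-! ### Weight spaces: shifts, independence, symmetry under permutations. -/

section Weights

variable {n : ℕ} {F : Type*} [Field F] {V : Type*} [AddCommGroup V] [Module F V]
  {ρ : Representation F (Matrix.GeneralLinearGroup (Fin n) F) V}

/-- The root `ε_a - ε_b`. -/
def root (a b : Fin n) : Fin n → ℤ := Pi.single a 1 - Pi.single b 1

theorem prod_zpow_add_smul_root (z : Fin n → Fˣ) (μ : Fin n → ℤ) (a b : Fin n) (k : ℤ) :
    ∏ c, z c ^ (μ + k • root a b) c = (∏ c, z c ^ μ c) * (z a / z b) ^ k := by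
  simp only [root, Pi.add_apply, Pi.smul_apply, Pi.sub_apply, zpow_add, prod_mul_distrib, smul_sub,
    zpow_sub, smul_eq_mul, div_zpow, Pi.single_apply]
  simp [apply_ite, div_eq_mul_inv]

theorem mem_weightSpace {μ : Fin n → ℤ} {v : V} :
    v ∈ weightSpace ρ μ ↔ ∀ t : Fin n → Fˣ, ρ (torus t) v = ((∏ a, t a ^ μ a : Fˣ) : F) • v :=
  Iff.rfl

theorem dividedPower_mem_weightSpace [Infinite F] (hr : IsRational ρ) {μ : Fin n → ℤ} {v : V}
    (hv : v ∈ weightSpace ρ μ) (a b : Fin n) (k : ℕ) :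
    dividedPower hr a b k v ∈ weightSpace ρ (μ + (k : ℤ) • root a b) := by
  intro z
  have h1 := (hasCoeff_dividedPower hr a b v).map (ρ (torus z))
  have h2 := ((hasCoeff_dividedPower hr a b v).scale (z a / z b : Fˣ)).map
    (((∏ c, z c ^ μ c : Fˣ) : F) • LinearMap.id)
  simp only [LinearMap.smul_apply, LinearMap.id_apply, ← map_smul] at h2
  simp only [← mem_weightSpace.1 hv z] at h2
  simp only [← Module.End.mul_apply, ← map_mul, torus_mul_rootElt] at h1 h2
  rw [← Module.End.mul_apply] at *
  have h3 := congrFun (h1.unique h2) k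
  rw [prod_zpow_add_smul_root, Units.val_mul, mul_smul, zpow_natCast, Units.val_pow_eq_pow_val]
  simpa using h3

theorem exists_unit_zpow_ne_one [Infinite F] {m : ℤ} (hm : m ≠ 0) : ∃ u : Fˣ, u ^ m ≠ 1 := by
  by_contra! h
  have h' : ∀ u : Fˣ, u ^ m.natAbs = 1 := by
    intro u
    rcases Int.natAbs_eq m with he | he
    · have := h u
      rw [he, zpow_natCast] at this
      exact this
    · have := h u
      rw [he, zpow_neg, zpow_natCast, inv_eq_one] at this
      exact this
  -- The extra factor `X` takes care of the point zero, which is not a unit.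
  have hp : (Polynomial.X * (Polynomial.X ^ m.natAbs - 1) : Polynomial F) = 0 := by
    refine Polynomial.funext fun x => ?_
    by_cases hx : x = 0
    · simp [hx]
    · have := congrArg Units.val (h' (Units.mk0 x hx))
      simp at this
      simp [this]
  rcases mul_eq_zero.1 hp with h0 | h0
  · exact Polynomial.X_ne_zero h0
  · exact (Polynomial.monic_X_pow_sub_C (1 : F) (Int.natAbs_ne_zero.2 hm)).ne_zero (by simpa using h0)

/-- Weight spaces lie in joint generalized eigenspaces of the commuting torus operators, and over an
infinite field different weights are different characters. -/
theorem iSupIndep_weightSpace [Infinite F]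
    (ρ : Representation F (Matrix.GeneralLinearGroup (Fin n) F) V) :
    iSupIndep (weightSpace ρ) := by
  have hcomm : ∀ z z' : Fin n → Fˣ, Commute (ρ (torus z)) (ρ (torus z')) := by
    intro z z'
    have : torus z * torus z' = torus z' * torus z := by
      apply Units.ext
      simp [torus, Matrix.diagonal_mul_diagonal, mul_comm]
    rw [Commute, SemiconjBy, ← map_mul, ← map_mul, this]
  have h := Module.End.independent_iInf_maxGenEigenspace_of_forall_mapsTo
    (fun z : Fin n → Fˣ => ρ (torus z))
    (fun i j φ => Module.End.mapsTo_maxGenEigenspace_of_comm (hcomm j i) φ)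
  have hinj : Function.Injective
      (fun (μ : Fin n → ℤ) (z : Fin n → Fˣ) => ((∏ a, z a ^ μ a : Fˣ) : F)) := by
    intro μ ν hμν
    by_contra hne
    obtain ⟨a, ha⟩ := Function.ne_iff.1 hne
    obtain ⟨u, hu⟩ := exists_unit_zpow_ne_one (F := F) (sub_ne_zero.2 ha)
    have h1 := Units.ext (congrFun hμν (Pi.mulSingle a u))
    have h2 : ∀ κ : Fin n → ℤ, ∏ b, (Pi.mulSingle a u : Fin n → Fˣ) b ^ κ b = u ^ κ a := by
      intro κ
      rw [prod_eq_single a] <;> simp +contextual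
    rw [h2, h2] at h1
    exact hu (by rw [zpow_sub, h1, mul_inv_cancel])
  refine (h.comp hinj).mono fun μ v hv => ?_
  simp only [Function.comp, Submodule.mem_iInf]
  intro z
  exact Module.End.genEigenspace_le_maximal _ _ 1
    (Module.End.mem_eigenspace_iff.2 (mem_weightSpace.1 hv z))

/-- A functional which vanishes on all weight spaces but `V_ν`. -/
def IsWeightFunctional (ρ : Representation F (Matrix.GeneralLinearGroup (Fin n) F) V)
    (ν : Fin n → ℤ) (ψ : V →ₗ[F] F) : Prop :=
  ∀ μ, μ ≠ ν → ∀ v ∈ weightSpace ρ μ, ψ v = 0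

/-- Independence alone gives this, so it is available before `V` is known to be the sum of its
weight spaces. -/
theorem exists_isWeightFunctional [Infinite F] {ν : Fin n → ℤ} {v : V}
    (hv : v ∈ weightSpace ρ ν) (h0 : v ≠ 0) : ∃ ψ, IsWeightFunctional ρ ν ψ ∧ ψ v = 1 := by
  have h1 : v ∉ ⨆ μ, ⨆ (_ : μ ≠ ν), weightSpace ρ μ := fun h =>
    h0 (Submodule.disjoint_def.1 (iSupIndep_weightSpace ρ ν) v hv h)
  obtain ⟨f, hf, hle⟩ := Submodule.exists_le_ker_of_notMem h1
  refine ⟨(f v)⁻¹ • f, fun μ hμ w hw => ?_, by simp [hf]⟩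
  have : f w = 0 := hle (Submodule.mem_iSup_of_mem μ (Submodule.mem_iSup_of_mem hμ hw))
  simp [this]

/-- Permutation matrices normalize the torus and permute its entries. -/
theorem weightSpace_comp_perm_ne_bot {μ : Fin n → ℤ} (h : weightSpace ρ μ ≠ ⊥)
    (σ : Equiv.Perm (Fin n)) : weightSpace ρ (μ ∘ σ) ≠ ⊥ := by
  obtain ⟨v, hv, h0⟩ := Submodule.exists_mem_ne_zero_of_ne_bot h
  have hdet : (σ.permMatrix F).det ≠ 0 := by
    rw [Matrix.det_permutation]
    rcases Int.units_eq_one_or (Equiv.Perm.sign σ) with h | h <;> simp [h]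
  let w : Matrix.GeneralLinearGroup (Fin n) F := Matrix.GeneralLinearGroup.mkOfDetNeZero _ hdet
  have hw : ∀ z, torus z * w = w * torus (z ∘ σ.symm) := by
    intro z
    apply Units.ext
    ext i j
    simp only [Units.val_mul, torus, w, Matrix.GeneralLinearGroup.mkOfDetNeZero,
      Matrix.diagonal_mul, Matrix.GeneralLinearGroup.mk', Matrix.unitOfDetInvertible,
      Matrix.mul_diagonal]
    simp only [Equiv.Perm.permMatrix]
    by_cases hij : σ i = j
    · subst hij; simp
    · simp [hij]
  refine (Submodule.ne_bot_iff _).2 ⟨ρ w v, fun z => ?_, fun h1 => h0 ?_⟩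
  · rw [← Module.End.mul_apply, ← map_mul, hw, map_mul, Module.End.mul_apply, hv, map_smul]
    congr 2
    rw [← Equiv.prod_comp σ]
    simp
  · have := congrArg (ρ w⁻¹) h1
    rwa [← Module.End.mul_apply, ← map_mul, inv_mul_cancel, map_one, map_zero] at this

end Weights

/-! ### Ordered products of root elements. -/

section RootProducts

variable {F : Type*}

/-- Products of elements `x a b t`, for `(a, b)` in a list. -/
inductive RootProd {G ι : Type*} [Monoid G] (x : ι → ι → F → G) : List (ι × ι) → G → Prop
  | nil : RootProd x [] 1
  | cons (a b : ι) (t : F) {R : List (ι × ι)} {g : G} :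
      RootProd x R g → RootProd x ((a, b) :: R) (x a b t * g)

theorem RootProd.append {G ι : Type*} [Monoid G] {x : ι → ι → F → G} {R R' : List (ι × ι)}
    {g g' : G} (h : RootProd x R g) (h' : RootProd x R' g') : RootProd x (R ++ R') (g * g') := by
  induction h with
  | nil => simpa using h'
  | cons a b t _ ih => simpa [mul_assoc] using RootProd.cons a b t ih

theorem RootProd.of_append {G ι : Type*} [Monoid G] {x : ι → ι → F → G} {R R' : List (ι × ι)}
    {g : G} (h : RootProd x (R ++ R') g) :
    ∃ g₁ g₂, RootProd x R g₁ ∧ RootProd x R' g₂ ∧ g = g₁ * g₂ := by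
  induction R generalizing g with
  | nil => exact ⟨1, g, .nil, h, by simp⟩
  | cons r R ih =>
    cases h with
    | cons a b t h =>
      obtain ⟨g₁, g₂, h₁, h₂, rfl⟩ := ih h
      exact ⟨_, g₂, .cons a b t h₁, h₂, by rw [mul_assoc]⟩

theorem RootProd.reverse {G ι : Type*} [Monoid G] {x : ι → ι → F → G} {R : List (ι × ι)}
    {g : G} {y : ι → ι → F → G} (τ : G → G) (h1 : τ 1 = 1) (hτ : ∀ g h, τ (g * h) = τ h * τ g)
    (hx : ∀ a b t, τ (x a b t) = y a b t)
    (h : RootProd x R g) : RootProd y R.reverse (τ g) := by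
  induction h with
  | nil => simpa [h1] using RootProd.nil
  | cons a b t _ ih =>
    rw [List.reverse_cons, hτ, hx]
    refine ih.append ?_
    simpa using RootProd.cons (x := y) a b t .nil

end RootProducts

/-! ### Density of the big cell lower · torus · upper. -/

section BigCell

variable {n : ℕ} {F : Type*} [Field F]

/-- Upper unitriangular matrices. -/
def IsUpperUni (U : Matrix (Fin n) (Fin n) F) : Prop :=
  (∀ i, U i i = 1) ∧ ∀ i j, j < i → U i j = 0

/-- A generic matrix has an `LDU` decomposition. -/
theorem exists_generic_LDU (n : ℕ) (F : Type*) [Field F] :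
    ∃ Q : MvPolynomial (Fin n × Fin n) F,
      (∃ M : Matrix (Fin n) (Fin n) F, MvPolynomial.eval (fun ij => M ij.1 ij.2) Q ≠ 0) ∧
      ∀ M : Matrix (Fin n) (Fin n) F, MvPolynomial.eval (fun ij => M ij.1 ij.2) Q ≠ 0 →
        ∃ (L : Matrix (Fin n) (Fin n) F) (D : Fin n → F) (U : Matrix (Fin n) (Fin n) F),
          IsUpperUni L.transpose ∧ IsUpperUni U ∧ M = L * Matrix.diagonal D * U := by
  induction n with
  | zero =>
    exact ⟨1, ⟨1, by simp⟩, fun M _ => ⟨1, 1, 1, ⟨fun i => i.elim0, fun i => i.elim0⟩,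
      ⟨fun i => i.elim0, fun i => i.elim0⟩, Subsingleton.elim _ _⟩⟩
  | succ n ih =>
    obtain ⟨Q, ⟨M₀, hM₀⟩, hQ⟩ := ih
    -- The smaller polynomial is evaluated at the Schur complement of the corner entry, multiplied
    -- by that entry so that the condition stays polynomial.
    have hev : ∀ M : Matrix (Fin (n + 1)) (Fin (n + 1)) F,
        MvPolynomial.eval (fun ij => M ij.1 ij.2) (MvPolynomial.bind₁ (fun ij : Fin n × Fin n =>
          (MvPolynomial.X (0, 0) * MvPolynomial.X (ij.1.succ, ij.2.succ) -
            MvPolynomial.X (ij.1.succ, 0) * MvPolynomial.X (0, ij.2.succ) :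
            MvPolynomial (Fin (n + 1) × Fin (n + 1)) F)) Q) =
        MvPolynomial.eval (fun ij => M 0 0 * M ij.1.succ ij.2.succ -
          M ij.1.succ 0 * M 0 ij.2.succ) Q := by
      intro M
      rw [MvPolynomial.eval, MvPolynomial.eval₂Hom_bind₁]
      simp
    refine ⟨MvPolynomial.X (0, 0) * MvPolynomial.bind₁ (fun ij : Fin n × Fin n =>
          (MvPolynomial.X (0, 0) * MvPolynomial.X (ij.1.succ, ij.2.succ) -
            MvPolynomial.X (ij.1.succ, 0) * MvPolynomial.X (0, ij.2.succ) :
            MvPolynomial (Fin (n + 1) × Fin (n + 1)) F)) Q, ⟨Matrix.of fun i j =>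
              Fin.cases (Fin.cases 1 (fun _ => 0) j)
                (fun i' => Fin.cases 0 (fun j' => M₀ i' j') j) i, ?_⟩, fun M hM => ?_⟩
    · rw [map_mul, hev]
      simpa using hM₀
    · rw [map_mul, hev] at hM
      have ha : M 0 0 ≠ 0 := by simpa using left_ne_zero_of_mul hM
      obtain ⟨L, D, U, hL, hU, hN⟩ := hQ (Matrix.of fun i j => M 0 0 * M i.succ j.succ -
          M i.succ 0 * M 0 j.succ) (by simpa using right_ne_zero_of_mul hM)
      -- One step of Gaussian elimination; dividing `D` by the corner entry undoes the scaling of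
      -- the Schur complement.
      refine ⟨Matrix.of fun i j => Fin.cases (Fin.cases 1 (fun _ => 0) j)
          (fun i' => Fin.cases (M i'.succ 0 / M 0 0) (fun j' => L i' j') j) i,
        Fin.cons (M 0 0) (fun k => D k / M 0 0),
        Matrix.of fun i j => Fin.cases (Fin.cases 1 (fun j' => M 0 j'.succ / M 0 0) j)
          (fun i' => Fin.cases 0 (fun j' => U i' j') j) i, ⟨?_, ?_⟩, ⟨?_, ?_⟩, ?_⟩
      · intro i
        refine Fin.cases (by simp) (fun i => ?_) i
        simpa using hL.1 i
      · intro i j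
        refine Fin.cases (by simp) (fun i => ?_) i
        refine Fin.cases (by simp) (fun j => ?_) j
        intro hij
        simpa using hL.2 i j (by simpa using hij)
      · intro i
        refine Fin.cases (by simp) (fun i => ?_) i
        simpa using hU.1 i
      · intro i j
        refine Fin.cases (by simp) (fun i => ?_) i
        refine Fin.cases (by simp) (fun j => ?_) j
        intro hij
        simpa using hU.2 i j (by simpa using hij)
      · ext i j
        rw [Matrix.mul_apply, Fin.sum_univ_succ]
        simp only [Matrix.mul_diagonal]
        refine Fin.cases ?_ (fun i => ?_) i <;> refine Fin.cases ?_ (fun j => ?_) j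
        · simp
        · simp; field_simp
        · simp; field_simp
        · have := congrFun (congrFun hN i) j
          rw [Matrix.mul_apply] at this
          simp only [Matrix.mul_diagonal, Matrix.of_apply] at this
          simp only [Matrix.of_apply, Fin.cases_succ, Fin.cases_zero, Fin.cons_zero, Fin.cons_succ]
          have h2 : ∑ x, L i x * (D x / M 0 0) * U x j = (∑ x, L i x * D x * U x j) / M 0 0 := by
            rw [sum_div]
            exact sum_congr rfl fun x _ => by ring
          rw [h2, ← this]
          field_simp
          ring

/-- The pairs `(a, b)` with `a < b`, sorted by rows in the order `l`. -/
def rowPairs (w l : List (Fin n)) : List (Fin n × Fin n) :=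
  l.flatMap fun a => (w.filter (a < ·)).map fun b => (a, b)

theorem rowPairs_append (w l l' : List (Fin n)) :
    rowPairs w (l ++ l') = rowPairs w l ++ rowPairs w l' := by
  simp [rowPairs]

theorem rowPairs_reverse (w l : List (Fin n)) :
    (rowPairs w l).reverse = rowPairs w.reverse l.reverse := by
  simp [rowPairs, List.reverse_flatMap, Function.comp_def]

theorem mem_rowPairs {w l : List (Fin n)} {a b : Fin n} :
    (a, b) ∈ rowPairs w l ↔ a ∈ l ∧ b ∈ w ∧ a < b := by
  simp [rowPairs]

theorem exists_rootProd_row (w : List (Fin n)) (hw : w.Nodup) (a : Fin n) (hlt : ∀ b ∈ w, a < b)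
    (r : Fin n → F) :
    ∃ g : Matrix.GeneralLinearGroup (Fin n) F, RootProd rootElt (w.map fun b => (a, b)) g ∧
      (g : Matrix (Fin n) (Fin n) F) = 1 + Matrix.of fun i j => if i = a ∧ j ∈ w then r j else 0 := by
  induction w with
  | nil => exact ⟨1, .nil, by ext; simp⟩
  | cons b w ih =>
    obtain ⟨g, hg, hval⟩ := ih hw.of_cons fun b hb => hlt b (List.mem_cons_of_mem _ hb)
    refine ⟨_, hg.cons a b (r b), ?_⟩
    have hab : a < b := hlt b List.mem_cons_self
    rw [Units.val_mul, coe_rootElt hab.ne, hval, add_mul, one_mul, mul_add, mul_one, add_assoc]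
    congr 1
    have h0 : Matrix.single a b (r b) * (Matrix.of fun i j => if i = a ∧ j ∈ w then r j else 0) =
        (0 : Matrix (Fin n) (Fin n) F) := by
      ext i j
      rw [Matrix.mul_apply]
      refine sum_eq_zero fun k _ => ?_
      by_cases hk : k = a
      · subst hk
        simp [hab.ne']
      · simp [hk]
    rw [h0, add_zero]
    ext i j
    have hbw : b ∉ w := (List.nodup_cons.1 hw).1
    by_cases hj : j = b
    · subst hj
      simp [Matrix.single_apply, hbw, eq_comm]
    · simp [hj, Ne.symm hj]

/-- Rows are split off on the right, from the end of `l`, so any order of rows is allowed. A cleared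
row `c ≠ a` stays cleared, because clearing row `a` changes it by a multiple of `U c a = 0`. -/
theorem IsUpperUni.exists_rootProd_mul {U : Matrix (Fin n) (Fin n) F} (hU : IsUpperUni U)
    {w : List (Fin n)} (hw : w.Nodup) (hmem : ∀ b, b ∈ w) (l : List (Fin n)) :
    ∃ (U' : Matrix (Fin n) (Fin n) F) (g : Matrix.GeneralLinearGroup (Fin n) F), IsUpperUni U' ∧
      RootProd rootElt (rowPairs w l) g ∧ U = U' * (g : Matrix (Fin n) (Fin n) F) ∧
      ∀ c, (c ∈ l ∨ ∀ j, U c j = (1 : Matrix (Fin n) (Fin n) F) c j) →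
        ∀ j, U' c j = (1 : Matrix (Fin n) (Fin n) F) c j := by
  induction l using List.reverseRecOn generalizing U with
  | nil => exact ⟨U, 1, hU, .nil, by simp, fun c hc => hc.resolve_left (by simp)⟩
  | append_singleton l a ih =>
    obtain ⟨g, hg, hval⟩ := exists_rootProd_row (w.filter (a < ·)) (hw.filter _) a (by simp) (U a)
    set U₁ : Matrix (Fin n) (Fin n) F := Matrix.of fun i j =>
      if a < j then U i j - U i a * U a j else U i j with hU₁
    have h₁ : IsUpperUni U₁ := by
      constructor
      · intro i
        by_cases h : a < i
        · simp [hU₁, h, hU.1, hU.2 i a h]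
        · simp [hU₁, h, hU.1]
      · intro i j hij
        by_cases h : a < j
        · simp [hU₁, h, hU.2 i j hij, hU.2 i a (h.trans hij)]
        · simp [hU₁, h, hU.2 i j hij]
    have hmul : U = U₁ * (g : Matrix (Fin n) (Fin n) F) := by
      rw [hval, mul_add, mul_one]
      ext i j
      rw [Matrix.add_apply, Matrix.mul_apply, sum_eq_single a]
      · by_cases h : a < j <;> simp [hU₁, h, hmem]
      · intro k _ hk
        simp [hk]
      · simp
    obtain ⟨U', g', hU', hg', hmul', hrow⟩ := ih h₁
    refine ⟨U', g' * g, hU', ?_, ?_, ?_⟩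
    · rw [rowPairs_append]
      refine hg'.append ?_
      simpa [rowPairs] using hg
    · rw [hmul, hmul', Units.val_mul, mul_assoc]
    · intro c hc
      refine hrow c ?_
      by_cases hca : c = a
      · right
        subst hca
        intro j
        by_cases h : c < j
        · simp [hU₁, h, hU.1, h.ne]
        · rcases eq_or_lt_of_le (not_lt.1 h) with h' | h'
          · subst h'; simp [hU₁, hU.1]
          · simp [hU₁, h, hU.2 c j h', h'.ne']
      · rcases hc with hc | hc
        · left
          simpa [hca] using hc
        · right
          intro j
          have : U c a = 0 := by rw [hc, Matrix.one_apply_ne hca]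
          by_cases h : a < j <;> simp [hU₁, h, this, hc]

theorem IsUpperUni.exists_rootProd {U : Matrix (Fin n) (Fin n) F} (hU : IsUpperUni U)
    {w : List (Fin n)} (hw : w.Nodup) (hmem : ∀ b, b ∈ w) {l : List (Fin n)} (hl : ∀ a, a ∈ l) :
    ∃ g : Matrix.GeneralLinearGroup (Fin n) F, RootProd rootElt (rowPairs w l) g ∧
      (g : Matrix (Fin n) (Fin n) F) = U := by
  obtain ⟨U', g, -, hg, hmul, hrow⟩ := hU.exists_rootProd_mul hw hmem l
  have : U' = 1 := by
    ext c j
    exact hrow c (Or.inl (hl c)) j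
  exact ⟨g, hg, by rw [hmul, this, one_mul]⟩

/-- Transposition on the general linear group. -/
def glTranspose (g : Matrix.GeneralLinearGroup (Fin n) F) : Matrix.GeneralLinearGroup (Fin n) F where
  val := (g : Matrix (Fin n) (Fin n) F).transpose
  inv := (↑g⁻¹ : Matrix (Fin n) (Fin n) F).transpose
  val_inv := by rw [← Matrix.transpose_mul, Units.inv_mul, Matrix.transpose_one]
  inv_val := by rw [← Matrix.transpose_mul, Units.mul_inv, Matrix.transpose_one]

theorem IsUpperUni.exists_rootProd_transpose {L : Matrix (Fin n) (Fin n) F}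
    (hL : IsUpperUni L.transpose)
    {w : List (Fin n)} (hw : w.Nodup) (hmem : ∀ b, b ∈ w) {l : List (Fin n)} (hl : ∀ a, a ∈ l) :
    ∃ g : Matrix.GeneralLinearGroup (Fin n) F,
      RootProd (fun a b => rootElt b a) (rowPairs w l) g ∧
      (g : Matrix (Fin n) (Fin n) F) = L := by
  obtain ⟨g, hg, hval⟩ := hL.exists_rootProd (w := w.reverse) (List.nodup_reverse.2 hw)
    (by simpa using hmem) (l := l.reverse) (by simpa using hl)
  refine ⟨glTranspose g, ?_, ?_⟩
  swap
  · simp [glTranspose, hval]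
  have := hg.reverse (y := fun a b => rootElt b a) glTranspose
    (by apply Units.ext; simp [glTranspose]) (fun g h => by apply Units.ext; simp [glTranspose])
    (fun a b t => by
      apply Units.ext
      by_cases h : a ≠ b
      · simp [glTranspose, coe_rootElt h, coe_rootElt h.symm]
      · simp [glTranspose, rootElt, not_not.1 h])
  rwa [rowPairs_reverse, List.reverse_reverse, List.reverse_reverse] at this

theorem IsRegularFunction.zero : IsRegularFunction
    (fun _ : Matrix.GeneralLinearGroup (Fin n) F => (0 : F)) := ⟨0, 0, by simp⟩

theorem IsRegularFunction.add {f f' : Matrix.GeneralLinearGroup (Fin n) F → F}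
    (hf : IsRegularFunction f) (hf' : IsRegularFunction f') :
    IsRegularFunction (fun g => f g + f' g) := by
  obtain ⟨P, m, hP⟩ := hf
  obtain ⟨P', m', hP'⟩ := hf'
  refine ⟨P * (Matrix.mvPolynomialX (Fin n) (Fin n) F).det ^ m' +
    P' * (Matrix.mvPolynomialX (Fin n) (Fin n) F).det ^ m, m + m', fun g => ?_⟩
  have hΔ : MvPolynomial.eval (fun ij => (g : Matrix (Fin n) (Fin n) F) ij.1 ij.2)
      (Matrix.mvPolynomialX (Fin n) (Fin n) F).det = (g : Matrix (Fin n) (Fin n) F).det := by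
    rw [RingHom.map_det]
    congr 1
    ext i j
    simp
  simp only [map_add, map_mul, map_pow, hΔ, ← hP, ← hP']
  ring

theorem IsRegularFunction.mul_const {f : Matrix.GeneralLinearGroup (Fin n) F → F}
    (hf : IsRegularFunction f) (c : F) : IsRegularFunction (fun g => f g * c) := by
  obtain ⟨P, m, hP⟩ := hf
  refine ⟨P * MvPolynomial.C c, m, fun g => ?_⟩
  rw [map_mul, ← hP, MvPolynomial.eval_C]
  ring

variable {V : Type*} [AddCommGroup V] [Module F V]
  {ρ : Representation F (Matrix.GeneralLinearGroup (Fin n) F) V}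

theorem IsRational.isRegularFunction_apply (hr : IsRational ρ) (ψ : V →ₗ[F] F) (v : V) :
    IsRegularFunction (fun g => ψ (ρ g v)) := by
  obtain ⟨r, f, w, hf, hv⟩ := hr v
  simp only [hv, map_sum, map_smul, smul_eq_mul]
  have : ∀ s : Finset (Fin r), IsRegularFunction (fun g => ∑ k ∈ s, f k g * ψ (w k)) := by
    intro s
    induction s using Finset.induction_on with
    | empty => simpa using IsRegularFunction.zero
    | insert a s ha ih =>
      simp only [sum_insert ha]
      exact ((hf a).mul_const _).add ih
  exact this univ

variable [Infinite F]

/-- The big cell is dense. -/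
theorem IsRegularFunction.eq_zero_of_bigCell {f : Matrix.GeneralLinearGroup (Fin n) F → F}
    (hf : IsRegularFunction f) {w l l' : List (Fin n)} (hw : w.Nodup) (hmem : ∀ b, b ∈ w)
    (hl : ∀ a, a ∈ l) (hl' : ∀ a, a ∈ l')
    (h : ∀ g z g', RootProd (fun a b => rootElt b a) (rowPairs w l) g →
      RootProd rootElt (rowPairs w l') g' → f (g * torus z * g') = 0)
    (g : Matrix.GeneralLinearGroup (Fin n) F) : f g = 0 := by
  obtain ⟨P, m, hP⟩ := hf
  obtain ⟨Q, ⟨M₀, hM₀⟩, hQ⟩ := exists_generic_LDU n F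
  set Δ : MvPolynomial (Fin n × Fin n) F := (Matrix.mvPolynomialX (Fin n) (Fin n) F).det with hΔ
  have hΔev : ∀ M : Matrix (Fin n) (Fin n) F,
      MvPolynomial.eval (fun ij => M ij.1 ij.2) Δ = M.det := by
    intro M
    rw [hΔ, RingHom.map_det]
    congr 1
    ext i j
    simp
  -- At each matrix either `Q` or the determinant vanishes, or the matrix lies in the big cell,
  -- where `f` vanishes by hypothesis.
  have hprod : P * (Q * Δ) = 0 := by
    refine MvPolynomial.funext fun x => ?_
    obtain ⟨M, rfl⟩ : ∃ M : Matrix (Fin n) (Fin n) F, x = fun ij => M ij.1 ij.2 :=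
      ⟨Matrix.of fun i j => x (i, j), rfl⟩
    rw [map_mul, map_mul, hΔev, map_zero]
    by_cases hQ0 : MvPolynomial.eval (fun ij => M ij.1 ij.2) Q = 0
    · rw [hQ0]; ring
    by_cases hd : M.det = 0
    · rw [hd]; ring
    obtain ⟨L, D, U, hL, hU, hM⟩ := hQ M hQ0
    obtain ⟨gL, hgL, hgL'⟩ := IsUpperUni.exists_rootProd_transpose hL hw hmem hl
    obtain ⟨gU, hgU, hgU'⟩ := hU.exists_rootProd hw hmem hl'
    have hD : ∀ k, D k ≠ 0 := by
      intro k hk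
      apply hd
      rw [hM, Matrix.det_mul, Matrix.det_mul, Matrix.det_diagonal,
        prod_eq_zero (mem_univ k) hk]
      ring
    have h0 := h gL (fun k => Units.mk0 (D k) (hD k)) gU hgL hgU
    have h1 := hP (gL * torus (fun k => Units.mk0 (D k) (hD k)) * gU)
    have h2 : ((gL * torus (fun k => Units.mk0 (D k) (hD k)) * gU :
        Matrix.GeneralLinearGroup (Fin n) F) : Matrix (Fin n) (Fin n) F) = M := by
      rw [hM, Units.val_mul, Units.val_mul, hgL', hgU']
      rfl
    rw [h0, zero_mul, h2] at h1
    rw [← h1, zero_mul]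
  have hQ0 : Q ≠ 0 := by
    rintro rfl
    simp at hM₀
  have hΔ0 : Δ ≠ 0 := by
    intro h0
    have := hΔev 1
    simp [h0] at this
  have hP0 : P = 0 := (mul_eq_zero.1 hprod).resolve_right (mul_ne_zero hQ0 hΔ0)
  have h1 := hP g
  rw [hP0, map_zero] at h1
  refine (mul_eq_zero.1 h1).resolve_right (pow_ne_zero _ ?_)
  exact (Matrix.isUnits_det_units g).ne_zero

end BigCell

/-! ### Which sorted monomials in root operators have a given weight. -/

section Monomials

variable {n : ℕ} {A : Type*} [Monoid A]

theorem root_apply (a b c : Fin n) :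
    root a b c = (if c = a then 1 else 0) - (if c = b then 1 else 0) := by
  simp [root, Pi.single_apply]

/-- `Monomial y R β X`: the element `X` is a product of `y a b k` over the pairs `(a, b)` in the
list `R`, and `β` is the corresponding sum of `k (ε_a - ε_b)`. -/
inductive Monomial (y : Fin n → Fin n → ℕ → A) : List (Fin n × Fin n) → (Fin n → ℤ) → A → Prop
  | nil : Monomial y [] 0 1
  | cons (a b : Fin n) (k : ℕ) {R : List (Fin n × Fin n)} {β : Fin n → ℤ} {X : A} :
      Monomial y R β X → Monomial y ((a, b) :: R) (β + (k : ℤ) • root a b) (y a b k * X)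

variable {y : Fin n → Fin n → ℕ → A} {R : List (Fin n × Fin n)} {β : Fin n → ℤ} {X : A}

theorem Monomial.exists_of_cons {r : Fin n × Fin n} (h : Monomial y (r :: R) β X) :
    ∃ (k : ℕ) (β' : Fin n → ℤ) (X' : A), Monomial y R β' X' ∧ β = β' + (k : ℤ) • root r.1 r.2 ∧
      X = y r.1 r.2 k * X' := by
  cases h with
  | cons a b k h => exact ⟨k, _, _, h, rfl, rfl⟩

/-- Only a pair ending at `c` contributes negatively to the coordinate `c`. -/
theorem Monomial.coord_nonneg (h : Monomial y R β X) {c : Fin n} (hc : ∀ r ∈ R, r.2 ≠ c) :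
    0 ≤ β c := by
  induction h with
  | nil => simp
  | cons a b k _ ih =>
    have h1 := ih fun r hr => hc r (List.mem_cons_of_mem _ hr)
    have h2 : b ≠ c := hc (a, b) List.mem_cons_self
    simp only [Pi.add_apply, Pi.smul_apply, root_apply, if_neg h2.symm, sub_zero]
    split_ifs <;> simp <;> omega

theorem Monomial.coord_nonpos (h : Monomial y R β X) {c : Fin n} (hc : ∀ r ∈ R, r.1 ≠ c) :
    β c ≤ 0 := by
  induction h with
  | nil => simp
  | cons a b k _ ih =>
    have h1 := ih fun r hr => hc r (List.mem_cons_of_mem _ hr)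
    have h2 : a ≠ c := hc (a, b) List.mem_cons_self
    simp only [Pi.add_apply, Pi.smul_apply, root_apply, if_neg h2.symm]
    split_ifs <;> simp <;> omega

theorem sum_Iic_root {a b : Fin n} (m : Fin n) :
    ∑ c ∈ Iic m, root a b c = (if a ≤ m then 1 else 0) - (if b ≤ m then 1 else 0) := by
  simp [root, Pi.single_apply]

/-- The partial sums of `β` are its coefficients in the simple roots. -/
theorem Monomial.sum_nonneg (h : Monomial y R β X) (hR : ∀ r ∈ R, r.1 < r.2) (m : Fin n) :
    0 ≤ ∑ c ∈ Iic m, β c := by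
  induction h with
  | nil => simp
  | cons a b k _ ih =>
    have h1 := ih fun r hr => hR r (List.mem_cons_of_mem _ hr)
    have h2 : a < b := hR (a, b) List.mem_cons_self
    simp only [Pi.add_apply, Pi.smul_apply, sum_add_distrib, ← smul_sum, sum_Iic_root]
    split_ifs with h3 h4 h4
    · simpa
    · simp; omega
    · exact absurd (h2.le.trans h4) h3
    · simpa

theorem Monomial.eq_one (hy : ∀ a b, y a b 0 = 1) (h : Monomial y R β X) (hR : ∀ r ∈ R, r.1 < r.2) (h0 : β = 0) : X = 1 := by
  induction h with
  | nil => rfl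
  | @cons a b k R β X h ih =>
    have h1 := h.sum_nonneg (fun r hr => hR r (List.mem_cons_of_mem _ hr)) a
    have h2 : a < b := hR (a, b) List.mem_cons_self
    have h3 : ∑ c ∈ Iic a, (β + (k : ℤ) • root a b) c = 0 := by rw [h0]; simp
    simp only [Pi.add_apply, Pi.smul_apply, sum_add_distrib, ← smul_sum, sum_Iic_root,
      if_neg h2.not_ge] at h3
    simp at h3
    have hk : k = 0 := by omega
    subst hk
    rw [hy, one_mul]
    exact ih (fun r hr => hR r (List.mem_cons_of_mem _ hr)) (by simpa using h0)

/-- Lists of positive roots `(a, b)`, `a < b`, sorted by `a`. -/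
def IsSortedRoots (R : List (Fin n × Fin n)) : Prop :=
  R.Pairwise (fun r r' => r.1 ≤ r'.1) ∧ ∀ r ∈ R, r.1 < r.2

theorem IsSortedRoots.of_cons {r : Fin n × Fin n} (h : IsSortedRoots (r :: R)) : IsSortedRoots R :=
  ⟨h.1.of_cons, fun r hr => h.2 r (List.mem_cons_of_mem _ hr)⟩

/-- After the head `(a, b)` no pair starts before `a` or ends at or before `a`. The resulting signs
of the remaining weight pin down the head pair and its exponent in the classifications below. -/
theorem Monomial.cases_of_sorted (hy : ∀ a b, y a b 0 = 1) {a b : Fin n}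
    (h : Monomial y ((a, b) :: R) β X) (hR : IsSortedRoots ((a, b) :: R)) :
    Monomial y R β X ∨ ∃ (k : ℕ) (β' : Fin n → ℤ) (X' : A), 1 ≤ k ∧ Monomial y R β' X' ∧
      X = y a b k * X' ∧ β' = β - (k : ℤ) • root a b ∧
      (∀ c, β' c = β c - (if c = a then (k : ℤ) else 0) + (if c = b then (k : ℤ) else 0)) ∧
      (∀ c, c ≤ a → 0 ≤ β' c) ∧ (∀ c, c < a → β' c ≤ 0) := by
  obtain ⟨k, β', X', h', hβ, hX⟩ := h.exists_of_cons
  simp only at hβ hX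
  rcases Nat.eq_zero_or_pos k with rfl | hk
  · left
    rw [hX, hβ, hy]
    simpa using h'
  · refine Or.inr ⟨k, β', X', hk, h', hX, by rw [hβ, add_sub_cancel_right], fun c => ?_,
      fun c hc => h'.coord_nonneg fun r hr => ?_, fun c hc => h'.coord_nonpos fun r hr => ?_⟩
    · rw [hβ, Pi.add_apply, Pi.smul_apply, root_apply]
      split_ifs <;> simp
    · have h1 := hR.of_cons.2 r hr
      have h2 : a ≤ r.1 := (List.pairwise_cons.1 hR.1).1 r hr
      exact (hc.trans_lt (h2.trans_lt h1)).ne'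
    · have h2 : a ≤ r.1 := (List.pairwise_cons.1 hR.1).1 r hr
      exact (hc.trans_le h2).ne'

/-- Products `y a₀ a₁ 1 * y a₁ a₂ 1 * ⋯ * y a_{r-1} a_r 1` with `i = a₀ < a₁ < ⋯ < a_{r-1} < p`
and `a_r = j`. -/
inductive Chain (y : Fin n → Fin n → ℕ → A) (p : Fin n) : Fin n → Fin n → A → Prop
  | single (i j : Fin n) : Chain y p i j (y i j 1)
  | cons (i b j : Fin n) {X : A} (hib : i < b) (hbp : b < p) :
      Chain y p b j X → Chain y p i j (y i b 1 * X)

/-- The first pair with positive exponent must be `(i, b)` with exponent one, and it leaves the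
weight `root b j`. -/
theorem Monomial.chain (hy : ∀ a b, y a b 0 = 1) {i j : Fin n} (hij : i < j)
    (h : Monomial y R (root i j) X) (hR : IsSortedRoots R) : Chain y j i j X := by
  induction R generalizing i X with
  | nil =>
    exfalso
    have h1 := h.coord_nonpos (c := i) (by simp)
    simp [root_apply, hij.ne] at h1
  | cons r R ih =>
    obtain ⟨a, b⟩ := r
    have hab : a < b := hR.2 _ List.mem_cons_self
    rcases h.cases_of_sorted hy hR with h' | ⟨k, β', X', hk, h', rfl, hβ', hβ, hnn, hnp⟩
    · exact ih hij h' hR.of_cons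
    simp only [root_apply] at hβ
    have hai : a = i := by
      rcases lt_trichotomy a i with hlt | heq | hlt
      · have h1 := hnn a le_rfl
        rw [hβ] at h1
        simp [hlt.ne, (hlt.trans hij).ne, hab.ne] at h1
        omega
      · exact heq
      · have h1 := hnp i hlt
        rw [hβ] at h1
        simp [hlt.ne, (hlt.trans hab).ne, hij.ne] at h1
    subst hai
    have hk1 : k = 1 := by
      have h1 := hnn a le_rfl
      rw [hβ] at h1
      simp [hij.ne, hab.ne] at h1
      omega
    subst hk1
    have hβ2 : β' = root b j := by
      rw [hβ']
      simp [root]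
    subst hβ2
    rcases lt_trichotomy b j with hlt | heq | hlt
    · exact .cons _ _ _ hab hlt (ih hlt h' hR.of_cons)
    · subst heq
      rw [h'.eq_one hy hR.of_cons.2 (by simp [root]), mul_one]
      exact .single _ _
    -- Overshooting `j` would make the partial sum up to `j` equal to `-1`.
    · have := h'.sum_nonneg hR.of_cons.2 j
      rw [sum_Iic_root] at this
      simp [hlt.not_ge] at this

/-- No pair starts beyond `p`, so coordinates beyond `p` cannot be positive and a path leaving `p`
must stop at once. The membership in `R` serves `Monomial.eq_square`. -/
theorem Monomial.eq_single (hy : ∀ a b, y a b 0 = 1) {p q : Fin n} (hpq : p < q)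
    (h : Monomial y R (root p q) X) (hR : IsSortedRoots R) (hp : ∀ r ∈ R, r.1 ≤ p) :
    (p, q) ∈ R ∧ X = y p q 1 := by
  induction R generalizing X with
  | nil =>
    exfalso
    have h1 := h.coord_nonpos (c := p) (by simp)
    simp [root_apply, hpq.ne] at h1
  | cons r R ih =>
    obtain ⟨a, b⟩ := r
    have hab : a < b := hR.2 _ List.mem_cons_self
    have hp' : ∀ r ∈ R, r.1 ≤ p := fun r hr => hp r (List.mem_cons_of_mem _ hr)
    rcases h.cases_of_sorted hy hR with h' | ⟨k, β', X', hk, h', rfl, hβ', hβ, hnn, hnp⟩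
    · exact (ih h' hR.of_cons hp').imp (List.mem_cons_of_mem _) id
    simp only [root_apply] at hβ
    have hap : a = p := by
      refine (hp _ List.mem_cons_self).eq_of_not_lt fun hlt => ?_
      have h1 := hnn a le_rfl
      rw [hβ] at h1
      simp only at hlt
      simp [hlt.ne, (hlt.trans hpq).ne, hab.ne] at h1
      omega
    subst hap
    have hk1 : k = 1 := by
      have h1 := hnn a le_rfl
      rw [hβ] at h1
      simp [hpq.ne, hab.ne] at h1
      omega
    subst hk1
    have hbq : b = q := by
      by_contra hne
      have h1 := h'.coord_nonpos (c := b) fun r hr => ((hp' r hr).trans_lt hab).ne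
      rw [hβ] at h1
      simp [hab.ne', hne] at h1
    subst hbq
    rw [h'.eq_one hy hR.of_cons.2 (by rw [hβ']; simp), mul_one]
    exact ⟨List.mem_cons_self, rfl⟩

theorem Monomial.eq_pair (hy : ∀ a b, y a b 0 = 1) {p q q' : Fin n} (hpq : p < q) (hpq' : p < q')
    (hne : q ≠ q') (h : Monomial y R (root p q + root p q') X) (hR : IsSortedRoots R)
    (hp : ∀ r ∈ R, r.1 ≤ p) : X = y p q 1 * y p q' 1 ∨ X = y p q' 1 * y p q 1 := by
  induction R generalizing X with
  | nil =>
    exfalso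
    have h1 := h.coord_nonpos (c := p) (by simp)
    simp [root_apply, hpq.ne, hpq'.ne] at h1
  | cons r R ih =>
    obtain ⟨a, b⟩ := r
    have hab : a < b := hR.2 _ List.mem_cons_self
    have hp' : ∀ r ∈ R, r.1 ≤ p := fun r hr => hp r (List.mem_cons_of_mem _ hr)
    rcases h.cases_of_sorted hy hR with h' | ⟨k, β', X', hk, h', rfl, hβ', hβ, hnn, hnp⟩
    · exact ih h' hR.of_cons hp'
    simp only [Pi.add_apply, root_apply] at hβ
    have hap : a = p := by
      refine (hp _ List.mem_cons_self).eq_of_not_lt fun hlt => ?_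
      have h1 := hnn a le_rfl
      rw [hβ] at h1
      simp only at hlt
      simp [hlt.ne, (hlt.trans hpq).ne, (hlt.trans hpq').ne, hab.ne] at h1
      omega
    subst hap
    have hb := h'.coord_nonpos (c := b) fun r hr => ((hp' r hr).trans_lt hab).ne
    rw [hβ] at hb
    simp only [hab.ne', if_false, if_true] at hb
    have hk1 : k = 1 := by split_ifs at hb <;> omega
    subst hk1
    by_cases hbq : b = q
    · subst hbq
      left
      rw [(Monomial.eq_single (X := X') hy hpq' (by convert h'; rw [hβ']; simp) hR.of_cons hp').2]
    · by_cases hbq' : b = q'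
      · subst hbq'
        right
        rw [(Monomial.eq_single (X := X') hy hpq (by convert h'; rw [hβ']; simp) hR.of_cons hp').2]
      · simp [hbq, hbq'] at hb

/-- Since `R` has no repetition, `(p, q)` occurs once and must carry exponent two: a divided square
appears, not a square. -/
theorem Monomial.eq_square (hy : ∀ a b, y a b 0 = 1) {p q : Fin n} (hpq : p < q)
    (h : Monomial y R (root p q + root p q) X) (hR : IsSortedRoots R)
    (hp : ∀ r ∈ R, r.1 ≤ p) (hnd : R.Nodup) : X = y p q 2 := by
  induction R generalizing X with
  | nil =>
    exfalso
    have h1 := h.coord_nonpos (c := p) (by simp)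
    simp [root_apply, hpq.ne] at h1
  | cons r R ih =>
    obtain ⟨a, b⟩ := r
    have hab : a < b := hR.2 _ List.mem_cons_self
    have hp' : ∀ r ∈ R, r.1 ≤ p := fun r hr => hp r (List.mem_cons_of_mem _ hr)
    rcases h.cases_of_sorted hy hR with h' | ⟨k, β', X', hk, h', rfl, hβ', hβ, hnn, hnp⟩
    · exact ih h' hR.of_cons hp' hnd.of_cons
    simp only [Pi.add_apply, root_apply] at hβ
    have hap : a = p := by
      refine (hp _ List.mem_cons_self).eq_of_not_lt fun hlt => ?_
      have h1 := hnn a le_rfl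
      rw [hβ] at h1
      simp only at hlt
      simp [hlt.ne, (hlt.trans hpq).ne, hab.ne] at h1
      omega
    subst hap
    have hb := h'.coord_nonpos (c := b) fun r hr => ((hp' r hr).trans_lt hab).ne
    rw [hβ] at hb
    simp only [hab.ne', if_false, if_true] at hb
    have hbq : b = q := by
      by_contra hbq
      simp [hbq] at hb
      omega
    subst hbq
    have hk2 : k = 1 ∨ k = 2 := by simp at hb; omega
    rcases hk2 with rfl | rfl
    · exact absurd (Monomial.eq_single (X := X') hy hpq (by convert h'; rw [hβ']; simp) hR.of_cons hp').1
        (List.nodup_cons.1 hnd).1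
    · rw [h'.eq_one hy hR.of_cons.2 (by rw [hβ']; simp [two_smul]), mul_one]

/-- Peeling off the first root of a monomial of weight `root i q + root p q'`. -/
theorem Monomial.peel (hy : ∀ a b, y a b 0 = 1) {i p q q' a b : Fin n} (hip : i < p) (hpq : p < q)
    (hpq' : p < q') (h : Monomial y ((a, b) :: R) (root i q + root p q') X)
    (hR : IsSortedRoots ((a, b) :: R)) (hp : ∀ r ∈ R, r.1 ≤ p) :
    Monomial y R (root i q + root p q') X ∨ ∃ X', a = i ∧ X = y i b 1 * X' ∧
      Monomial y R (root b q + root p q') X' ∧ (b ≤ p ∨ b = q ∨ b = q') := by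
  have hab : a < b := hR.2 _ List.mem_cons_self
  rcases h.cases_of_sorted hy hR with h' | ⟨k, β', X', hk, h', rfl, hβ', hβ, hnn, hnp⟩
  · exact Or.inl h'
  right
  simp only [Pi.add_apply, root_apply] at hβ
  have hai : a = i := by
    rcases lt_trichotomy a i with hlt | heq | hlt
    · have h1 := hnn a le_rfl
      rw [hβ] at h1
      simp [hlt.ne, (hlt.trans hip).ne, ((hlt.trans hip).trans hpq).ne,
        ((hlt.trans hip).trans hpq').ne, hab.ne] at h1
      omega
    · exact heq
    · have h1 := hnp i hlt
      rw [hβ] at h1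
      simp [hlt.ne, (hlt.trans hab).ne, hip.ne, (hip.trans hpq).ne, (hip.trans hpq').ne] at h1
  subst hai
  have hk1 : k = 1 := by
    have h1 := hnn a le_rfl
    rw [hβ] at h1
    simp [hip.ne, (hip.trans hpq).ne, (hip.trans hpq').ne, hab.ne] at h1
    omega
  subst hk1
  refine ⟨X', rfl, rfl, ?_, ?_⟩
  · convert h'
    rw [hβ']
    simp only [root]
    simp
    abel
  · by_contra! hcon
    have h1 := h'.coord_nonpos (c := b) fun r hr => ((hp r hr).trans_lt hcon.1).ne
    rw [hβ] at h1
    simp [hab.ne', hcon.1.ne', hcon.2.1, hcon.2.2] at h1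

/-- A path from `i` that passes `p` stops there, at `q` or at `q'`; otherwise it reaches `p`, and
both final steps leave from `p`. The three cases become the block rows and columns of `matM`. -/
theorem Monomial.chain_mul (hy : ∀ a b, y a b 0 = 1) {i p q q' : Fin n} (hip : i < p) (hpq : p < q)
    (hpq' : p < q') (hne : q ≠ q') (h : Monomial y R (root i q + root p q') X)
    (hR : IsSortedRoots R) (hp : ∀ r ∈ R, r.1 ≤ p) :
    (∃ Z, Chain y p i q Z ∧ X = Z * y p q' 1) ∨ (∃ Z, Chain y p i q' Z ∧ X = Z * y p q 1) ∨
      ∃ Z, Chain y p i p Z ∧ (X = Z * (y p q 1 * y p q' 1) ∨ X = Z * (y p q' 1 * y p q 1)) := by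
  induction R generalizing i X with
  | nil =>
    exfalso
    have h1 := h.coord_nonpos (c := p) (by simp)
    simp [root_apply, hip.ne', hpq.ne, hpq'.ne] at h1
  | cons r R ih =>
    obtain ⟨a, b⟩ := r
    have hab : a < b := hR.2 _ List.mem_cons_self
    have hp' : ∀ r ∈ R, r.1 ≤ p := fun r hr => hp r (List.mem_cons_of_mem _ hr)
    rcases h.peel hy hip hpq hpq' hR hp' with h' | ⟨X', rfl, rfl, h', hb⟩
    · exact ih hip h' hR.of_cons hp'
    rcases hb with hb | rfl | rfl
    · rcases hb.lt_or_eq with hlt | rfl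
      · rcases ih hlt h' hR.of_cons hp' with ⟨Z, hZ, rfl⟩ | ⟨Z, hZ, rfl⟩ | ⟨Z, hZ, hX⟩
        · exact Or.inl ⟨_, .cons _ _ _ hab hlt hZ, by rw [mul_assoc]⟩
        · exact Or.inr (Or.inl ⟨_, .cons _ _ _ hab hlt hZ, by rw [mul_assoc]⟩)
        · refine Or.inr (Or.inr ⟨_, .cons _ _ _ hab hlt hZ, ?_⟩)
          rcases hX with rfl | rfl <;> simp [mul_assoc]
      · refine Or.inr (Or.inr ⟨_, .single _ _, ?_⟩)
        rcases h'.eq_pair hy hpq hpq' hne hR.of_cons hp' with rfl | rfl <;> simp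
    · refine Or.inl ⟨_, .single _ _, ?_⟩
      rw [(Monomial.eq_single (X := X') hy hpq' (by simpa [root] using h') hR.of_cons hp').2]
    · refine Or.inr (Or.inl ⟨_, .single _ _, ?_⟩)
      rw [(Monomial.eq_single (X := X') hy hpq (by simpa [root] using h') hR.of_cons hp').2]

/-- The degenerate case `q = q'` of `Monomial.chain_mul`: the two mixed families merge and the pair
becomes a divided square. The two cases become the blocks of `matW`. -/
theorem Monomial.chain_mul_square (hy : ∀ a b, y a b 0 = 1) {i p q : Fin n} (hip : i < p)
    (hpq : p < q) (h : Monomial y R (root i q + root p q) X)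
    (hR : IsSortedRoots R) (hp : ∀ r ∈ R, r.1 ≤ p) (hnd : R.Nodup) :
    (∃ Z, Chain y p i q Z ∧ X = Z * y p q 1) ∨ ∃ Z, Chain y p i p Z ∧ X = Z * y p q 2 := by
  induction R generalizing i X with
  | nil =>
    exfalso
    have h1 := h.coord_nonpos (c := p) (by simp)
    simp [root_apply, hip.ne', hpq.ne] at h1
  | cons r R ih =>
    obtain ⟨a, b⟩ := r
    have hab : a < b := hR.2 _ List.mem_cons_self
    have hp' : ∀ r ∈ R, r.1 ≤ p := fun r hr => hp r (List.mem_cons_of_mem _ hr)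
    rcases h.peel hy hip hpq hpq hR hp' with h' | ⟨X', rfl, rfl, h', hb⟩
    · exact ih hip h' hR.of_cons hp' hnd.of_cons
    rcases hb with hb | hb
    · rcases hb.lt_or_eq with hlt | rfl
      · rcases ih hlt h' hR.of_cons hp' hnd.of_cons with ⟨Z, hZ, rfl⟩ | ⟨Z, hZ, rfl⟩
        · exact Or.inl ⟨_, .cons _ _ _ hab hlt hZ, by rw [mul_assoc]⟩
        · exact Or.inr ⟨_, .cons _ _ _ hab hlt hZ, by rw [mul_assoc]⟩
      · refine Or.inr ⟨_, .single _ _, ?_⟩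
        rw [h'.eq_square hy hpq hR.of_cons hp' hnd.of_cons]
    · obtain rfl : b = q := hb.elim id id
      refine Or.inl ⟨_, .single _ _, ?_⟩
      rw [(Monomial.eq_single (X := X') hy hpq (by simpa [root] using h') hR.of_cons hp').2]

end Monomials

/-! ### Indexing chains by `Idx d`. -/

section ChainProducts

variable {A : Type*} [Monoid A]

/-- The products `y a₀ a₁ 1 * y a₁ a₂ 1 * ⋯ * y a_{r-1} a_r 1` with `a₀ = i`, `a_r = j` and
intermediate points in `{i + 1, …, i + d}`, indexed by the sets of intermediate points. -/
def chainProd (y : ℕ → ℕ → ℕ → A) (i : ℕ) : (d : ℕ) → Idx d → ℕ → A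
  | 0, _, j => y i j 1
  | d + 1, B, j => Sum.elim (fun B' : Idx d => chainProd y i d B' j)
      (fun B' : Idx d => chainProd y i d B' (i + d + 1) * y (i + d + 1) j 1) B

variable (y : ℕ → ℕ → ℕ → A)

theorem exists_chainProd_single (i d j : ℕ) : ∃ B : Idx d, chainProd y i d B j = y i j 1 := by
  induction d with
  | zero => exact ⟨(), rfl⟩
  | succ d ih =>
    obtain ⟨B, hB⟩ := ih
    exact ⟨Sum.inl B, hB⟩

/-- `chainProd` recurses on the largest intermediate point while `Chain` grows at the smallest; this
bridges the two. -/
theorem exists_chainProd_cons (i e d : ℕ) (B : Idx d) (j : ℕ) :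
    ∃ B' : Idx (e + 1 + d), chainProd y i (e + 1 + d) B' j =
      y i (i + e + 1) 1 * chainProd y (i + e + 1) d B j := by
  induction d generalizing j with
  | zero =>
    obtain ⟨B', hB'⟩ := exists_chainProd_single y i e (i + e + 1)
    exact ⟨Sum.inr B', by
      change chainProd y i e B' (i + e + 1) * y (i + e + 1) j 1 = _
      rw [hB']
      rfl⟩
  | succ d ih =>
    rcases B with B | B
    · obtain ⟨B', hB'⟩ := ih B j
      exact ⟨Sum.inl B', hB'⟩
    · obtain ⟨B', hB'⟩ := ih B (i + e + 1 + d + 1)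
      refine ⟨Sum.inr B', ?_⟩
      change chainProd y i (e + 1 + d) B' (i + (e + 1 + d) + 1) * y (i + (e + 1 + d) + 1) j 1 =
        y i (i + e + 1) 1 * (chainProd y (i + e + 1) d B (i + e + 1 + d + 1) *
          y (i + e + 1 + d + 1) j 1)
      rw [← mul_assoc, ← hB', show i + (e + 1 + d) + 1 = i + e + 1 + d + 1 by ring]

/-- The index `a ∈ {1, …, n}` as an element of `Fin n`. -/
def toFin (n : ℕ) [NeZero n] (a : ℕ) : Fin n := Fin.ofNat n (a - 1)

theorem toFin_val {n : ℕ} [NeZero n] {a : ℕ} (h1 : 1 ≤ a) (h2 : a ≤ n) :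
    (toFin n a : ℕ) = a - 1 := by
  simp only [toFin, Fin.ofNat]
  exact Nat.mod_eq_of_lt (by omega)

@[simp] theorem toFin_val_add_one {n : ℕ} [NeZero n] (a : Fin n) : toFin n (a + 1) = a := by
  apply Fin.ext
  rw [toFin_val] <;> omega

theorem Chain.exists_chainProd {n : ℕ} [NeZero n] {y : Fin n → Fin n → ℕ → A} {p i j : Fin n} {X : A}
    (h : Chain y p i j X) (d : ℕ) (hd : (p : ℕ) = i + 1 + d) :
    ∃ B : Idx d, X = chainProd (fun a b k => y (toFin n a) (toFin n b) k) (i + 1) d B (j + 1) := by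
  induction h generalizing d with
  | single i j =>
    obtain ⟨B, hB⟩ := exists_chainProd_single (fun a b k => y (toFin n a) (toFin n b) k)
      (i + 1) d (j + 1)
    exact ⟨B, by rw [hB]; simp⟩
  | cons i b j hib hbp _ ih =>
    obtain ⟨B, rfl⟩ := ih (p - b - 1) (by omega)
    obtain ⟨e, he⟩ : ∃ e, (b : ℕ) = i + e + 1 := ⟨b - i - 1, by omega⟩
    obtain ⟨B', hB'⟩ := exists_chainProd_cons (fun a b k => y (toFin n a) (toFin n b) k)
      (i + 1) e (p - b - 1) B (j + 1)
    have hd' : e + 1 + (p - b - 1) = d := by omega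
    subst hd'
    refine ⟨B', ?_⟩
    rw [hB']
    have : (i : ℕ) + 1 + e + 1 = b + 1 := by omega
    simp only [this, toFin_val_add_one]

end ChainProducts

/-! ### The Gram matrix of chain products and its recursion. -/

section Gram

/-- The Gram matrix between the chain products, with `l j` replaced by `x`. -/
def gram (l : ℕ → ℤ) (i : ℕ) : (d : ℕ) → ℤ → Matrix (Idx d) (Idx d) ℤ
  | 0, x => Matrix.of fun _ _ => l i - x
  | d + 1, x => Matrix.fromBlocks (gram l i d x) (gram l i d (l (i + d + 1)) - gram l i d x)
      (gram l i d (l (i + d + 1))) ((l (i + d + 1) - x) • gram l i d (l (i + d + 1)))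

theorem sub_fromBlocks {m : Type*} (A B C D A' B' C' D' : Matrix m m ℤ) :
    Matrix.fromBlocks A B C D - Matrix.fromBlocks A' B' C' D' =
      Matrix.fromBlocks (A - A') (B - B') (C - C') (D - D') := by
  rw [sub_eq_add_neg, Matrix.fromBlocks_neg, Matrix.fromBlocks_add]
  simp only [sub_eq_add_neg]

/-- Hence `X(i) + Y(u*)` is the Gram matrix with endpoint value `λ_{u*}`, and the block recursion
for `Y` is the difference of two Gram recursions. -/
theorem matXY_eq_gram {n : ℕ} (lam : Fin n → ℤ) (i j d : ℕ) :
    (matXY lam i j d).1 i = gram (entry lam) i d (entry lam j) ∧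
    ∀ k, (matXY lam i j d).2 k =
      gram (entry lam) i d (entry lam k) - gram (entry lam) i d (entry lam j) := by
  induction d with
  | zero =>
    refine ⟨rfl, fun k => ?_⟩
    ext a b
    simp [matXY, gram]
  | succ d ih =>
    obtain ⟨h1, h2⟩ := ih
    constructor
    · simp only [matXY, gram, h1, h2]
      congr 1 <;> simp
    · intro k
      simp only [matXY, gram, h1, h2]
      refine Eq.trans ?_ (sub_fromBlocks (gram (entry lam) i d (entry lam k)) _ _ _
        (gram (entry lam) i d (entry lam j)) _ _ _).symm
      congr 1
      · abel
      · abel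
      · rw [add_sub_cancel, ← sub_smul]
        congr 1
        ring

variable {F V : Type*} [Field F] [AddCommGroup V] [Module F V]

/-- Operators `e a b k = E_{ab}^{(k)}` on a module, a highest weight vector `v`, and a functional
`φ` with `φ v = 1` which is killed by lowering operators. -/
structure IsHighestWeightSystem (n : ℕ) (e : ℕ → ℕ → ℕ → Module.End F V) (l : ℕ → ℤ) (v : V)
    (φ : V →ₗ[F] F) : Prop where
  comm : ∀ {a b c d k m : ℕ}, (1 ≤ a ∧ a ≤ n) ∧ (1 ≤ b ∧ b ≤ n) ∧ (1 ≤ c ∧ c ≤ n) ∧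
    (1 ≤ d ∧ d ≤ n) ∧ b ≠ c ∧ a ≠ d → Commute (e a b k) (e c d m)
  one_mul_one : ∀ {a b c : ℕ}, (1 ≤ a ∧ a ≤ n) ∧ (1 ≤ b ∧ b ≤ n) ∧ (1 ≤ c ∧ c ≤ n) ∧
    a ≠ b ∧ b ≠ c ∧ a ≠ c → e a b 1 * e b c 1 = e b c 1 * e a b 1 + e a c 1
  two_mul_one : ∀ {a b c : ℕ}, (1 ≤ a ∧ a ≤ n) ∧ (1 ≤ b ∧ b ≤ n) ∧ (1 ≤ c ∧ c ≤ n) ∧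
    a ≠ b ∧ b ≠ c ∧ a ≠ c → e a b 2 * e b c 1 = e b c 1 * e a b 2 + e a c 1 * e a b 1
  raise : ∀ {a b : ℕ}, 1 ≤ a ∧ a < b ∧ b ≤ n → e a b 1 v = 0
  lower : ∀ {a b : ℕ}, 1 ≤ a ∧ a < b ∧ b ≤ n → ∀ w, φ (e b a 1 w) = 0
  cartan : ∀ {a b : ℕ}, 1 ≤ a ∧ a < b ∧ b ≤ n → e a b 1 (e b a 1 v) = ((l a - l b : ℤ) : F) • v
  norm : φ v = 1

/-- The chain products in the lowering operators. -/
abbrev lowerProd (e : ℕ → ℕ → ℕ → Module.End F V) (i d : ℕ) (B : Idx d) (j : ℕ) : Module.End F V :=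
  chainProd (fun a b k => e b a k) i d B j

/-- The chain products in the raising operators. -/
abbrev upperProd (e : ℕ → ℕ → ℕ → Module.End F V) (i d : ℕ) (B : Idx d) (j : ℕ) : Module.End F V :=
  chainProd e i d B j

namespace IsHighestWeightSystem

variable {n : ℕ} {e : ℕ → ℕ → ℕ → Module.End F V} {l : ℕ → ℤ} {v : V} {φ : V →ₗ[F] F}

/-- The factors of the chain have indices in `i, …, i + d` and `b`; the condition `w ≠ b` excludes
the only possible bracket. -/
theorem commute_lowerProd (S : IsHighestWeightSystem n e l v φ) {i d b u w k : ℕ} (B : Idx d)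
    (h : 1 ≤ i ∧ i + d < b ∧ b ≤ n ∧ i + d < u ∧ u ≤ n ∧ i + d < w ∧ w ≤ n ∧ w ≠ b) :
    Commute (lowerProd e i d B b) (e u w k) := by
  induction d generalizing b with
  | zero => exact S.comm (by omega)
  | succ d ih =>
    rcases B with B | B
    · exact ih B (by omega)
    · exact (ih B (by omega)).mul_left (S.comm (by omega))

theorem commute_upperProd (S : IsHighestWeightSystem n e l v φ) {i d b u w k : ℕ} (B : Idx d)
    (h : 1 ≤ i ∧ i + d < b ∧ b ≤ n ∧ i + d < u ∧ u ≤ n ∧ i + d < w ∧ w ≤ n ∧ u ≠ b) :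
    Commute (upperProd e i d B b) (e u w k) := by
  induction d generalizing b with
  | zero => exact S.comm (by omega)
  | succ d ih =>
    rcases B with B | B
    · exact ih B (by omega)
    · exact (ih B (by omega)).mul_left (S.comm (by omega))

/-- Only the last link of the chain fails to commute with `e j c 1`, and the bracket redirects its
endpoint from `c` to `j`. The next three lemmas work in the same way. -/
theorem lowerProd_mul (S : IsHighestWeightSystem n e l v φ) {i d c j : ℕ} (B : Idx d)
    (h : 1 ≤ i ∧ i + d < c ∧ c ≤ n ∧ i + d < j ∧ j ≤ n ∧ c ≠ j) :
    lowerProd e i d B c * e j c 1 = e j c 1 * lowerProd e i d B c - lowerProd e i d B j := by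
  induction d with
  | zero =>
    change e c i 1 * e j c 1 = e j c 1 * e c i 1 - e j i 1
    rw [S.one_mul_one (by omega), add_sub_cancel_right]
  | succ d ih =>
    rcases B with B | B
    · exact ih B (by omega)
    · have h1 := (S.commute_lowerProd (i := i) (b := i + d + 1) (u := j) (w := c) (k := 1) B (by omega)).eq
      have h2 := S.one_mul_one (a := j) (b := c) (c := i + d + 1) (by omega)
      have h3 : e c (i + d + 1) 1 * e j c 1 = e j c 1 * e c (i + d + 1) 1 - e j (i + d + 1) 1 := by
        rw [h2, add_sub_cancel_right]
      change lowerProd e i d B (i + d + 1) * e c (i + d + 1) 1 * e j c 1 =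
        e j c 1 * (lowerProd e i d B (i + d + 1) * e c (i + d + 1) 1) -
          lowerProd e i d B (i + d + 1) * e j (i + d + 1) 1
      rw [mul_assoc, h3, mul_sub, ← mul_assoc, ← mul_assoc, h1]

theorem upperProd_mul (S : IsHighestWeightSystem n e l v φ) {i d c j : ℕ} (B : Idx d)
    (h : 1 ≤ i ∧ i + d < c ∧ c ≤ n ∧ i + d < j ∧ j ≤ n ∧ c ≠ j) :
    upperProd e i d B j * e j c 1 = e j c 1 * upperProd e i d B j + upperProd e i d B c := by
  induction d with
  | zero => exact S.one_mul_one (by omega)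
  | succ d ih =>
    rcases B with B | B
    · exact ih B (by omega)
    · have h1 := (S.commute_upperProd (i := i) (b := i + d + 1) (u := j) (w := c) (k := 1) B (by omega)).eq
      have h2 := S.one_mul_one (a := i + d + 1) (b := j) (c := c) (by omega)
      change upperProd e i d B (i + d + 1) * e (i + d + 1) j 1 * e j c 1 =
        e j c 1 * (upperProd e i d B (i + d + 1) * e (i + d + 1) j 1) +
          upperProd e i d B (i + d + 1) * e (i + d + 1) c 1
      rw [mul_assoc, h2, mul_add, ← mul_assoc, ← mul_assoc, h1]

theorem mul_lowerProd (S : IsHighestWeightSystem n e l v φ) {i d c j : ℕ} (B : Idx d)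
    (h : 1 ≤ i ∧ i + d < c ∧ c ≤ n ∧ i + d < j ∧ j ≤ n ∧ c ≠ j) :
    e c j 1 * lowerProd e i d B j = lowerProd e i d B j * e c j 1 + lowerProd e i d B c := by
  induction d with
  | zero => exact S.one_mul_one (by omega)
  | succ d ih =>
    rcases B with B | B
    · exact ih B (by omega)
    · have h1 := (S.commute_lowerProd (i := i) (b := i + d + 1) (u := c) (w := j) (k := 1) B (by omega)).eq
      have h2 := S.one_mul_one (a := c) (b := j) (c := i + d + 1) (by omega)
      change e c j 1 * (lowerProd e i d B (i + d + 1) * e j (i + d + 1) 1) =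
        lowerProd e i d B (i + d + 1) * e j (i + d + 1) 1 * e c j 1 +
          lowerProd e i d B (i + d + 1) * e c (i + d + 1) 1
      rw [← mul_assoc, ← h1, mul_assoc, h2, mul_add, ← mul_assoc]

theorem two_mul_lowerProd (S : IsHighestWeightSystem n e l v φ) {i d c j : ℕ} (B : Idx d)
    (h : 1 ≤ i ∧ i + d < c ∧ c ≤ n ∧ i + d < j ∧ j ≤ n ∧ c ≠ j) :
    e c j 2 * lowerProd e i d B j =
      lowerProd e i d B j * e c j 2 + lowerProd e i d B c * e c j 1 := by
  induction d with
  | zero => exact S.two_mul_one (by omega)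
  | succ d ih =>
    rcases B with B | B
    · exact ih B (by omega)
    · have h1 := (S.commute_lowerProd (i := i) (b := i + d + 1) (u := c) (w := j) (k := 2) B (by omega)).eq
      have h2 := S.two_mul_one (a := c) (b := j) (c := i + d + 1) (by omega)
      change e c j 2 * (lowerProd e i d B (i + d + 1) * e j (i + d + 1) 1) =
        lowerProd e i d B (i + d + 1) * e j (i + d + 1) 1 * e c j 2 +
          lowerProd e i d B (i + d + 1) * e c (i + d + 1) 1 * e c j 1
      rw [← mul_assoc, ← h1, mul_assoc, h2, mul_add, ← mul_assoc, ← mul_assoc]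

theorem apply_lowerProd (S : IsHighestWeightSystem n e l v φ) {i d c j : ℕ} (B : Idx d)
    (h : 1 ≤ i ∧ i + d < c ∧ c < j ∧ j ≤ n) :
    e c j 1 (lowerProd e i d B j v) = lowerProd e i d B c v := by
  rw [← Module.End.mul_apply, S.mul_lowerProd B (by omega), LinearMap.add_apply,
    Module.End.mul_apply, S.raise (by omega), map_zero, zero_add]

/-- The operator `e j c 1` is moved to the left through both chains. Each passage leaves a chain
with a changed endpoint, and at the far left `φ` kills the lowering operator. -/
theorem pairing_swap (S : IsHighestWeightSystem n e l v φ) {i d c j : ℕ} (A B : Idx d)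
    (h : 1 ≤ i ∧ i + d < c ∧ c < j ∧ j ≤ n) :
    φ (upperProd e i d A j (lowerProd e i d B c (e j c 1 v))) =
      φ (upperProd e i d A c (lowerProd e i d B c v)) -
        φ (upperProd e i d A j (lowerProd e i d B j v)) := by
  rw [← Module.End.mul_apply (lowerProd e i d B c), S.lowerProd_mul B (by omega),
    LinearMap.sub_apply, Module.End.mul_apply, map_sub, map_sub, ← Module.End.mul_apply
    (upperProd e i d A j) (e j c 1), S.upperProd_mul A (by omega), LinearMap.add_apply, map_add,
    Module.End.mul_apply, S.lower (by omega), zero_add]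

/-- The four blocks correspond to whether each chain uses the point `i + d + 1`. The endpoint `j`
varies in the induction because that point becomes the new endpoint. -/
theorem pairing (S : IsHighestWeightSystem n e l v φ) {i d j : ℕ} (A B : Idx d)
    (h : 1 ≤ i ∧ i + d < j ∧ j ≤ n) :
    φ (upperProd e i d A j (lowerProd e i d B j v)) = (gram l i d (l j) A B : F) := by
  induction d generalizing j with
  | zero =>
    change φ (e i j 1 (e j i 1 v)) = ((l i - l j : ℤ) : F)
    rw [S.cartan (by omega), map_smul, S.norm, smul_eq_mul, mul_one]
  | succ d ih =>
    rcases A with A | A <;> rcases B with B | B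
    · exact ih A B (by omega)
    · change φ (upperProd e i d A j (lowerProd e i d B (i + d + 1) (e j (i + d + 1) 1 v))) =
        ((gram l i d (l (i + d + 1)) A B - gram l i d (l j) A B : ℤ) : F)
      rw [S.pairing_swap A B (by omega), ih A B (by omega), ih A B (by omega), Int.cast_sub]
    · change φ (upperProd e i d A (i + d + 1) (e (i + d + 1) j 1 (lowerProd e i d B j v))) =
        ((gram l i d (l (i + d + 1)) A B : ℤ) : F)
      rw [S.apply_lowerProd B (by omega), ih A B (by omega)]
    · change φ (upperProd e i d A (i + d + 1) (e (i + d + 1) j 1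
        (lowerProd e i d B (i + d + 1) (e j (i + d + 1) 1 v)))) =
        (((l (i + d + 1) - l j) * gram l i d (l (i + d + 1)) A B : ℤ) : F)
      rw [← Module.End.mul_apply (e (i + d + 1) j 1), ← (S.commute_lowerProd B (by omega)).eq,
        Module.End.mul_apply, S.cartan (by omega), map_smul, map_smul, map_smul, ih A B (by omega),
        Int.cast_mul, smul_eq_mul]

theorem apply_lowerProd_single (S : IsHighestWeightSystem n e l v φ) {i d p q r : ℕ} (B : Idx d)
    (h : 1 ≤ i ∧ i + d < p ∧ p < q ∧ q ≤ n ∧ p < r ∧ r ≤ n ∧ q ≠ r) :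
    e p r 1 (lowerProd e i d B q (e r p 1 v)) =
      ((l p - l r : ℤ) : F) • lowerProd e i d B q v := by
  rw [← Module.End.mul_apply (e p r 1), ← (S.commute_lowerProd B (by omega)).eq,
    Module.End.mul_apply, S.cartan (by omega), map_smul]

theorem apply_lowerProd_other (S : IsHighestWeightSystem n e l v φ) {i d p q r : ℕ} (B : Idx d)
    (h : 1 ≤ i ∧ i + d < p ∧ p < q ∧ q ≤ n ∧ p < r ∧ r ≤ n ∧ q ≠ r) (hqr : e q r 1 v = 0) :
    e p r 1 (lowerProd e i d B r (e q p 1 v)) = lowerProd e i d B p (e q p 1 v) := by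
  have h1 : e p r 1 (e q p 1 v) = 0 := by
    have h2 := congrArg (fun X : Module.End F V => X v) (S.one_mul_one (a := q) (b := p) (c := r)
      (by omega))
    simp only [LinearMap.add_apply, Module.End.mul_apply, S.raise (a := p) (b := r) (by omega),
      map_zero, hqr, add_zero] at h2
    exact h2.symm
  rw [← Module.End.mul_apply (e p r 1), S.mul_lowerProd B (by omega), LinearMap.add_apply,
    Module.End.mul_apply, h1, map_zero, zero_add]

theorem apply_lowerProd_pair (S : IsHighestWeightSystem n e l v φ) {i d p q r : ℕ} (B : Idx d)
    (h : 1 ≤ i ∧ i + d < p ∧ p < q ∧ q ≤ n ∧ p < r ∧ r ≤ n ∧ q ≠ r)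
    (hr : e p r 1 (e r p 1 (e q p 1 v)) = ((l p - 1 : ℤ) : F) • e q p 1 v) :
    e p r 1 (lowerProd e i d B p (e q p 1 (e r p 1 v))) =
      ((l p - 1 : ℤ) : F) • lowerProd e i d B p (e q p 1 v) := by
  rw [← Module.End.mul_apply (e p r 1), ← (S.commute_lowerProd B (by omega)).eq,
    Module.End.mul_apply, ← Module.End.mul_apply (e q p 1), (S.comm (by omega)).eq,
    Module.End.mul_apply, hr, map_smul]

end IsHighestWeightSystem

end Gram

/-! ### Highest weight vectors, the dual functional, spanning and separation. -/

section HighestWeight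

variable {n : ℕ} {F : Type*} [Field F] {V : Type*} [AddCommGroup V] [Module F V]
  {ρ : Representation F (Matrix.GeneralLinearGroup (Fin n) F) V} {lam : Fin n → ℤ}

theorem epsilon_val_add_one (a : Fin n) : epsilon n (a + 1) = Pi.single a 1 := by
  ext b
  simp [epsilon, Pi.single_apply, Fin.ext_iff]

theorem Subdominant.sum_le {μ : Fin n → ℤ} (h : Subdominant μ lam) (m : Fin n) :
    ∑ c ∈ Iic m, μ c ≤ ∑ c ∈ Iic m, lam c := by
  have key : ∀ β ∈ AddSubmonoid.closure
      {β | ∃ r : ℕ, 1 ≤ r ∧ r < n ∧ β = simpleRoot n r}, 0 ≤ ∑ c ∈ Iic m, β c := by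
    intro β hβ
    induction hβ using AddSubmonoid.closure_induction with
    | mem β hβ =>
      obtain ⟨r, h1, h2, rfl⟩ := hβ
      have h3 : simpleRoot n r = root ⟨r - 1, by omega⟩ ⟨r, h2⟩ := by
        have e1 := epsilon_val_add_one (⟨r - 1, by omega⟩ : Fin n)
        have e2 := epsilon_val_add_one (⟨r, h2⟩ : Fin n)
        simp only [show r - 1 + 1 = r by omega] at e1
        rw [simpleRoot, root, e1, ← e2]
      rw [h3, sum_Iic_root]
      split_ifs with h4 h5 h5
      · simp
      · simp
      · exact absurd (le_trans (by simp [Fin.le_def]) h5) h4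
      · simp
    | zero => simp
    | add β β' _ _ h1 h2 =>
      simp only [Pi.add_apply, sum_add_distrib]
      omega
  have := key _ h
  simp only [Pi.sub_apply, sum_sub_distrib] at this
  omega

/-- For `a < b` such a weight would not be below `lam`. If `lam a = lam b`, the transposition of `a`
and `b` fixes `lam` and reverses the root. -/
theorem IsSimpleOfHighestWeight.weightSpace_add_eq_bot (hρ : IsSimpleOfHighestWeight ρ lam)
    {a b : Fin n} (hab : a < b ∨ a ≠ b ∧ lam a = lam b) {k : ℕ} (hk : 1 ≤ k) :
    weightSpace ρ (lam + (k : ℤ) • root a b) = ⊥ := by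
  have key : ∀ {a b : Fin n}, a < b → weightSpace ρ (lam + (k : ℤ) • root a b) = ⊥ := by
    intro a b hab
    by_contra h
    have h1 := (hρ.highest _ h).sum_le a
    simp only [Pi.add_apply, Pi.smul_apply, sum_add_distrib, ← smul_sum, sum_Iic_root,
      if_neg hab.not_ge] at h1
    simp at h1
    omega
  rcases hab with hab | ⟨hne, heq⟩
  · exact key hab
  rcases lt_or_gt_of_ne hne with hab | hab
  · exact key hab
  by_contra h
  refine weightSpace_comp_perm_ne_bot h (Equiv.swap a b) ?_
  convert key hab using 2
  ext c
  simp only [Function.comp, Pi.add_apply, Pi.smul_apply, root_apply]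
  by_cases hca : c = a
  · subst hca
    simp [heq, hne, hne.symm]
  · by_cases hcb : c = b
    · subst hcb
      simp [heq, hne, hne.symm]
    · simp [Equiv.swap_apply_of_ne_of_ne hca hcb, hca, hcb]

theorem RootProd.apply_eq {x : Fin n → Fin n → F → Matrix.GeneralLinearGroup (Fin n) F}
    {R : List (Fin n × Fin n)} {g : Matrix.GeneralLinearGroup (Fin n) F} (h : RootProd x R g) {v : V}
    (hv : ∀ r ∈ R, ∀ t, ρ (x r.1 r.2 t) v = v) : ρ g v = v := by
  induction h with
  | nil => simp
  | cons a b t _ ih =>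
    rw [map_mul, Module.End.mul_apply, ih fun r hr => hv r (List.mem_cons_of_mem _ hr)]
    exact hv (a, b) List.mem_cons_self t

theorem RootProd.functional_apply_eq
    {x : Fin n → Fin n → F → Matrix.GeneralLinearGroup (Fin n) F}
    {R : List (Fin n × Fin n)} {g : Matrix.GeneralLinearGroup (Fin n) F} (h : RootProd x R g)
    {φ : V →ₗ[F] F} (hφ : ∀ r ∈ R, ∀ t w, φ (ρ (x r.1 r.2 t) w) = φ w) (w : V) :
    φ (ρ g w) = φ w := by
  induction h with
  | nil => simp
  | cons a b t _ ih =>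
    rw [map_mul, Module.End.mul_apply, hφ (a, b) List.mem_cons_self t,
      ih fun r hr => hφ r (List.mem_cons_of_mem _ hr)]

theorem IsSimpleOfHighestWeight.eq_top_of_forall_mem (hρ : IsSimpleOfHighestWeight ρ lam)
    {W : Submodule F V} (hW : ∀ g, ∀ w ∈ W, ρ g w ∈ W) (h0 : W ≠ ⊥) : W = ⊤ := by
  have := hρ.simple
  rcases eq_bot_or_eq_top (⟨W, fun g w hw => hW g w hw⟩ : Subrepresentation ρ) with h | h
  · exact absurd (congrArg Subrepresentation.toSubmodule h) h0
  · exact congrArg Subrepresentation.toSubmodule h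

theorem IsSimpleOfHighestWeight.eq_zero_of_forall (hρ : IsSimpleOfHighestWeight ρ lam)
    {ψ : V →ₗ[F] F} (hψ : ψ ≠ 0) {w : V} (h : ∀ g, ψ (ρ g w) = 0) : w = 0 := by
  by_contra h0
  have htop : Submodule.span F (Set.range fun g => ρ g w) = ⊤ := by
    refine hρ.eq_top_of_forall_mem (fun g u hu => ?_) fun hbot => h0 ?_
    · induction hu using Submodule.span_induction with
      | mem u hu =>
        obtain ⟨g', rfl⟩ := hu
        refine Submodule.subset_span ⟨g * g', ?_⟩
        simp
      | zero => simp
      | add u u' _ _ h1 h2 => rw [map_add]; exact Submodule.add_mem _ h1 h2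
      | smul c u _ h1 => rw [map_smul]; exact Submodule.smul_mem _ c h1
    · have : w ∈ Submodule.span F (Set.range fun g => ρ g w) :=
        Submodule.subset_span ⟨1, by simp⟩
      rwa [hbot, Submodule.mem_bot] at this
  refine hψ (LinearMap.ext fun u => ?_)
  have hu : u ∈ Submodule.span F (Set.range fun g => ρ g w) := htop ▸ Submodule.mem_top
  have hle : Submodule.span F (Set.range fun g => ρ g w) ≤ LinearMap.ker ψ := by
    rw [Submodule.span_le]
    rintro _ ⟨g, rfl⟩
    exact h g
  exact hle hu

/-- Each root element acts as a finite sum of `t ^ k` times divided powers; multiply out. -/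
theorem RootProd.apply_mem_span {x : Fin n → Fin n → F → Matrix.GeneralLinearGroup (Fin n) F}
    {y : Fin n → Fin n → ℕ → Module.End F V}
    (hxy : ∀ a b u, HasCoeff (fun t => ρ (x a b t) u) (fun k => y a b k u))
    {R : List (Fin n × Fin n)} {g : Matrix.GeneralLinearGroup (Fin n) F} (h : RootProd x R g)
    (u : V) : ρ g u ∈ Submodule.span F {w | ∃ β X, Monomial y R β X ∧ w = X u} := by
  induction h with
  | nil => exact Submodule.subset_span ⟨0, 1, .nil, by simp⟩
  | @cons a b t R g h ih =>
    rw [map_mul, Module.End.mul_apply]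
    generalize ρ g u = u' at ih
    induction ih using Submodule.span_induction with
    | mem w hw =>
      obtain ⟨β, X, hX, rfl⟩ := hw
      obtain ⟨N, -, hN⟩ := hxy a b (X u)
      have hN' : ρ (x a b t) (X u) = ∑ k ∈ range N, t ^ k • y a b k (X u) := hN t
      rw [hN']
      exact Submodule.sum_mem _ fun k _ => Submodule.smul_mem _ _
        (Submodule.subset_span ⟨_, _, hX.cons a b k, rfl⟩)
    | zero => simp
    | add u u' _ _ h1 h2 => rw [map_add]; exact Submodule.add_mem _ h1 h2
    | smul c u _ h1 => rw [map_smul]; exact Submodule.smul_mem _ c h1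

theorem Monomial.apply_mem_weightSpace {y : Fin n → Fin n → ℕ → Module.End F V} (ε : ℤ)
    (hy : ∀ a b (k : ℕ) μ, ∀ u ∈ weightSpace ρ μ, y a b k u ∈ weightSpace ρ (μ + ε • (k : ℤ) • root a b))
    {R : List (Fin n × Fin n)} {β : Fin n → ℤ} {X : Module.End F V} (h : Monomial y R β X)
    {μ : Fin n → ℤ} {u : V} (hu : u ∈ weightSpace ρ μ) : X u ∈ weightSpace ρ (μ + ε • β) := by
  induction h with
  | nil => simpa using hu
  | cons a b k _ ih =>
    have := hy a b k _ _ ih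
    rwa [add_assoc, ← smul_add] at this

theorem prod_coroot_zpow {a b : Fin n} (hab : a ≠ b) (u : Fˣ) (μ : Fin n → ℤ) :
    ∏ c, coroot a b u c ^ μ c = u ^ (μ a - μ b) := by
  have : ∀ c, coroot a b u c ^ μ c =
      (if c = a then u ^ μ c else 1) * (if c = b then (u ^ μ c)⁻¹ else 1) := by
    intro c
    unfold coroot
    by_cases hca : c = a
    · subst hca
      simp [hab]
    · by_cases hcb : c = b
      · subst hcb
        simp [hca]
      · simp [hca, hcb]
  simp only [this, prod_mul_distrib, prod_ite_eq', mem_univ, if_true, zpow_sub]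

variable [Infinite F]

theorem lowering_mem_weightSpace (hr : IsRational ρ) (a b : Fin n) (k : ℕ) (μ : Fin n → ℤ) (u : V)
    (hu : u ∈ weightSpace ρ μ) :
    dividedPower hr b a k u ∈ weightSpace ρ (μ + (-1 : ℤ) • (k : ℤ) • root a b) := by
  have : (-1 : ℤ) • (k : ℤ) • root a b = (k : ℤ) • root b a := by
    rw [smul_comm]
    congr 1
    simp [root]
  rw [this]
  exact dividedPower_mem_weightSpace hr hu b a k

theorem raising_mem_weightSpace (hr : IsRational ρ) (a b : Fin n) (k : ℕ) (μ : Fin n → ℤ) (u : V)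
    (hu : u ∈ weightSpace ρ μ) :
    dividedPower hr a b k u ∈ weightSpace ρ (μ + (1 : ℤ) • (k : ℤ) • root a b) := by
  rw [one_smul]
  exact dividedPower_mem_weightSpace hr hu a b k

theorem IsSimpleOfHighestWeight.dividedPower_eq_zero (hρ : IsSimpleOfHighestWeight ρ lam)
    {a b : Fin n} (hab : a < b ∨ a ≠ b ∧ lam a = lam b) {k : ℕ} (hk : 1 ≤ k) {v : V}
    (hv : v ∈ weightSpace ρ lam) : dividedPower hρ.rational a b k v = 0 := by
  have := dividedPower_mem_weightSpace hρ.rational hv a b k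
  rwa [hρ.weightSpace_add_eq_bot hab hk, Submodule.mem_bot] at this

theorem apply_rootElt_eq {hr : IsRational ρ} {a b : Fin n} {v : V}
    (h : ∀ k, 1 ≤ k → dividedPower hr a b k v = 0) (t : F) : ρ (rootElt a b t) v = v := by
  obtain ⟨N, hN⟩ := (hasCoeff_dividedPower hr a b v).exists_bound
  rw [(hN (N + 1) (by omega)).2 t, sum_range_succ', sum_eq_zero, zero_add]
  · simp
  · intro k _
    rw [h _ (by omega), smul_zero]

theorem root_ne_zero {a b : Fin n} (h : a ≠ b) : root a b ≠ 0 := by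
  intro h0
  have := congrFun h0 a
  simp [root_apply, h] at this

theorem IsWeightFunctional.apply_rootElt {hr : IsRational ρ} {ν μ : Fin n → ℤ} {ψ : V →ₗ[F] F}
    (hψ : IsWeightFunctional ρ ν ψ) {a b : Fin n} (hab : a ≠ b) {k : ℕ}
    (hν : ν = μ + (k : ℤ) • root a b) {u : V} (hu : u ∈ weightSpace ρ μ) (t : F) :
    ψ (ρ (rootElt a b t) u) = t ^ k * ψ (dividedPower hr a b k u) := by
  obtain ⟨N, hN⟩ := (hasCoeff_dividedPower hr a b u).exists_bound
  rw [(hN (N + k + 1) (by omega)).2 t, map_sum, sum_eq_single k]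
  · simp
  · intro l _ hlk
    rw [map_smul, hψ _ _ _ (dividedPower_mem_weightSpace hr hu a b l), smul_zero]
    rw [hν]
    intro h
    have h1 := add_left_cancel h
    rw [← sub_eq_zero, ← sub_smul, smul_eq_zero, sub_eq_zero] at h1
    rcases h1 with h1 | h1
    · exact hlk (by exact_mod_cast h1)
    · exact root_ne_zero hab h1
  · intro h
    exact absurd (mem_range.2 (by omega)) h

theorem IsWeightFunctional.apply_rootElt_of_forall_ne (hr : IsRational ρ) {ν μ : Fin n → ℤ}
    {ψ : V →ₗ[F] F} (hψ : IsWeightFunctional ρ ν ψ) {a b : Fin n}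
    (hν : ∀ k : ℕ, ν ≠ μ + (k : ℤ) • root a b) {u : V} (hu : u ∈ weightSpace ρ μ) (t : F) :
    ψ (ρ (rootElt a b t) u) = 0 := by
  obtain ⟨N, -, hN⟩ := hasCoeff_dividedPower hr a b u
  have hN' : ρ (rootElt a b t) u = ∑ k ∈ range N, t ^ k • dividedPower hr a b k u := hN t
  rw [hN', map_sum]
  refine sum_eq_zero fun l _ => ?_
  rw [map_smul, hψ _ (hν l).symm _ (dividedPower_mem_weightSpace hr hu a b l), smul_zero]

/-- The action of `E_{ab}^{(k)}` on `E_{ba}^{(k + j)} w` for a vector `w` fixed by the root subgroup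
`1 + t E_{ab}`. -/
theorem dividedPower_dividedPower_apply (hr : IsRational ρ) {a b : Fin n} (hab : a ≠ b)
    {μ : Fin n → ℤ} {w : V} (hw : w ∈ weightSpace ρ μ) (hfix : ∀ t, ρ (rootElt a b t) w = w)
    {j m : ℕ} (hm : μ a - μ b = j + m) (k : ℕ) :
    dividedPower hr a b k (dividedPower hr b a (k + j) w) =
      (m.choose k : F) • dividedPower hr b a j w := by
  have hroot : root b a = -root a b := by simp [root]
  set ν := μ + (j : ℤ) • root b a with hν
  have hmem : ∀ l : ℕ, dividedPower hr b a l w ∈ weightSpace ρ (μ + (l : ℤ) • root b a) := fun l =>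
    dividedPower_mem_weightSpace hr hw b a l
  have hmem' : dividedPower hr a b k (dividedPower hr b a (k + j) w) ∈ weightSpace ρ ν := by
    have := dividedPower_mem_weightSpace hr (hmem (k + j)) a b k
    convert this using 2
    rw [hν, hroot]
    push_cast
    module
  -- Both vectors have weight `ν`, so a nonzero difference would be detected by a weight functional.
  rw [← sub_eq_zero]
  by_contra h0
  obtain ⟨ψ, hψ, h1⟩ := exists_isWeightFunctional
    (Submodule.sub_mem _ hmem' (Submodule.smul_mem _ (m.choose k : F) (hmem j))) h0
  obtain ⟨N, hN⟩ := (hasCoeff_dividedPower hr b a w).exists_bound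
  set M := N + k + j + 1
  have hM := (hN M (by omega)).2 1
  -- Both sides express `ψ` of `x_ab(t) x_ba(1) w` as a polynomial in `t`.
  have hP : (∑ l ∈ range M, if j ≤ l then Polynomial.monomial (l - j)
      (ψ (dividedPower hr a b (l - j) (dividedPower hr b a l w))) else 0 : Polynomial F) =
      (1 + Polynomial.X) ^ m * Polynomial.C (ψ (dividedPower hr b a j w)) := by
    -- The `SL_2` factorization fails at `t = -1`; multiplying by `1 + X` makes that point harmless.
    have hX : (1 + Polynomial.X : Polynomial F) ≠ 0 := by
      intro h
      have := congrArg (fun P => Polynomial.coeff P 1) h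
      simp [Polynomial.coeff_one] at this
    refine mul_left_cancel₀ hX (Polynomial.funext fun t => ?_)
    rw [Polynomial.eval_mul, Polynomial.eval_mul]
    by_cases ht : 1 + t = 0
    · simp [ht]
    congr 1
    have hl : ψ (ρ (rootElt a b t) (ρ (rootElt b a 1) w)) = ∑ l ∈ range M, if j ≤ l then
        t ^ (l - j) * ψ (dividedPower hr a b (l - j) (dividedPower hr b a l w)) else 0 := by
      rw [hM, map_sum, map_sum]
      refine sum_congr rfl fun l _ => ?_
      rw [one_pow, one_smul]
      split_ifs with hjl
      · refine hψ.apply_rootElt hab ?_ (hmem l) t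
        rw [hν, hroot, Nat.cast_sub hjl]
        module
      · refine hψ.apply_rootElt_of_forall_ne hr (fun i hi => ?_) (hmem l) t
        rw [hν, hroot, add_assoc] at hi
        have h2 := add_left_cancel hi
        rw [← sub_eq_zero, show (j : ℤ) • -root a b - ((l : ℤ) • -root a b + (i : ℤ) • root a b) =
          ((l : ℤ) - j - i) • root a b by module, smul_eq_zero] at h2
        rcases h2 with h2 | h2
        · omega
        · exact root_ne_zero hab h2
    have hr' : ψ (ρ (rootElt a b t) (ρ (rootElt b a 1) w)) =
        (1 + t) ^ m * ψ (dividedPower hr b a j w) := by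
      have hrel := rootElt_mul_rootElt_opp hab 1 t (Units.mk0 (1 + t) ht) (by simp)
      rw [← Module.End.mul_apply, ← map_mul, hrel, map_mul, map_mul, Module.End.mul_apply, hfix,
        Module.End.mul_apply, hw, prod_coroot_zpow hab, map_smul, map_smul,
        hψ.apply_rootElt (hr := hr) hab.symm hν hw, hm, Units.val_zpow_eq_zpow_val, Units.val_mk0,
        smul_eq_mul, ← mul_assoc]
      congr 1
      -- The torus contributes `(1 + t) ^ (j + m)` and the lower root element `(1 + t) ^ (-j)`.
      rw [zpow_add₀ ht, zpow_natCast, zpow_natCast, mul_comm, ← mul_assoc, ← mul_pow,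
        one_div_mul_cancel ht, one_pow, one_mul]
    rw [Polynomial.eval_mul, Polynomial.eval_pow, Polynomial.eval_add, Polynomial.eval_one,
      Polynomial.eval_X, Polynomial.eval_C, ← hr', hl, Polynomial.eval_finsetSum]
    refine sum_congr rfl fun l _ => ?_
    split_ifs
    · simp [mul_comm]
    · simp
  have hcoef := congrArg (fun P => Polynomial.coeff P k) hP
  simp only [Polynomial.coeff_mul_C, Polynomial.coeff_one_add_X_pow,
    Polynomial.finsetSum_coeff] at hcoef
  rw [sum_eq_single (k + j)] at hcoef
  · rw [if_pos (by omega), Nat.add_sub_cancel, Polynomial.coeff_monomial, if_pos rfl] at hcoef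
    rw [map_sub, map_smul, hcoef, smul_eq_mul, sub_self] at h1
    exact zero_ne_one h1
  · intro l _ hl
    split_ifs with hjl
    · rw [Polynomial.coeff_monomial, if_neg (by omega)]
    · simp
  · intro h
    exact absurd (mem_range.2 (by omega)) h

/-- The positive roots `(a, b)` with `a ≤ p`, sorted by `a`. -/
def sortedRoots (p : Fin n) : List (Fin n × Fin n) :=
  rowPairs (List.finRange n) ((List.finRange n).filter (· ≤ p))

theorem isSortedRoots_sortedRoots (p : Fin n) : IsSortedRoots (sortedRoots p) := by
  refine ⟨?_, fun r hr => (mem_rowPairs.1 hr).2.2⟩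
  rw [sortedRoots, rowPairs, List.pairwise_flatMap]
  constructor
  · intro a _
    rw [List.pairwise_map]
    exact List.pairwise_of_forall fun _ _ => le_rfl
  · refine List.Pairwise.filter _ ((List.pairwise_lt_finRange n).imp ?_)
    intro a b hab r hr r' hr'
    simp only [List.mem_map] at hr hr'
    obtain ⟨c, -, rfl⟩ := hr
    obtain ⟨c', -, rfl⟩ := hr'
    exact hab.le

theorem nodup_sortedRoots (p : Fin n) : (sortedRoots p).Nodup := by
  rw [sortedRoots, rowPairs, List.nodup_flatMap]
  constructor
  · intro a _
    exact ((List.nodup_finRange n).filter _).map fun b c h => (Prod.ext_iff.1 h).2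
  · refine List.Pairwise.filter _ ((List.pairwise_lt_finRange n).imp ?_)
    intro a b hab r hr hr'
    simp only [List.mem_map] at hr hr'
    obtain ⟨c, -, rfl⟩ := hr
    obtain ⟨c', -, h⟩ := hr'
    exact hab.ne' (Prod.ext_iff.1 h).1

theorem fst_le_of_mem_sortedRoots {p : Fin n} : ∀ r ∈ sortedRoots p, r.1 ≤ p := fun r hr => by
  simpa using (mem_rowPairs.1 hr).1

namespace IsSimpleOfHighestWeight

theorem apply_rootElt (hρ : IsSimpleOfHighestWeight ρ lam) {a b : Fin n}
    (hab : a < b ∨ a ≠ b ∧ lam a = lam b) {v : V} (hv : v ∈ weightSpace ρ lam) (t : F) :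
    ρ (rootElt a b t) v = v :=
  apply_rootElt_eq (hr := hρ.rational) (fun _ hk => hρ.dividedPower_eq_zero hab hk hv) t

/-- A functional that kills all monomials kills the big cell applied to `v`, hence by density the
whole orbit of `v`, which spans `V`. -/
theorem span_monomial_eq_top (hρ : IsSimpleOfHighestWeight ρ lam) {p : Fin n}
    (hp : ∀ a b, p < a → p < b → lam a = lam b) {v : V} (hv : v ∈ weightSpace ρ lam) (h0 : v ≠ 0) :
    Submodule.span F {w | ∃ β X,
      Monomial (fun a b => dividedPower hρ.rational b a) (sortedRoots p) β X ∧ w = X v} = ⊤ := by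
  by_contra htop
  obtain ⟨ψ, hψ, hker⟩ := Submodule.exists_le_ker_of_lt_top _ (lt_top_iff_ne_top.2 htop)
  refine h0 (hρ.eq_zero_of_forall hψ fun g => ?_)
  refine (hρ.rational.isRegularFunction_apply ψ v).eq_zero_of_bigCell (List.nodup_finRange n)
    -- Rows beyond `p` stand on the right, next to `v`, which they fix.
    (List.mem_finRange) (l := (List.finRange n).filter (· ≤ p) ++ (List.finRange n).filter (p < ·))
    (l' := List.finRange n) (fun a => ?_) List.mem_finRange (fun g z g' hg hg' => ?_) g
  · simp [le_or_gt]
  · rw [rowPairs_append] at hg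
    obtain ⟨g₁, g₂, hg₁, hg₂, rfl⟩ := hg.of_append
    have e1 : ρ g' v = v := hg'.apply_eq fun r hr t =>
      hρ.apply_rootElt (Or.inl (mem_rowPairs.1 hr).2.2) hv t
    have e2 : ρ g₂ v = v := hg₂.apply_eq fun r hr t => by
      obtain ⟨h1, -, h3⟩ := mem_rowPairs.1 hr
      have h4 : p < r.1 := by simpa using h1
      exact hρ.apply_rootElt (Or.inr ⟨h3.ne', hp _ _ (h4.trans h3) h4⟩) hv t
    rw [map_mul, map_mul, map_mul, Module.End.mul_apply, Module.End.mul_apply, Module.End.mul_apply,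
      e1, hv z, map_smul, map_smul, e2, map_smul]
    have e3 : ψ (ρ g₁ v) = 0 := hker (hg₁.apply_mem_span
      (fun a b u => hasCoeff_dividedPower hρ.rational b a u) v)
    rw [e3, smul_zero]

/-- Monomials are weight homogeneous, so independence of weight spaces discards those of other
weights. -/
theorem weightSpace_le_span (hρ : IsSimpleOfHighestWeight ρ lam) {p : Fin n}
    (hp : ∀ a b, p < a → p < b → lam a = lam b) {v : V} (hv : v ∈ weightSpace ρ lam) (h0 : v ≠ 0)
    (β : Fin n → ℤ) :
    weightSpace ρ (lam - β) ≤ Submodule.span F {w | ∃ X,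
      Monomial (fun a b => dividedPower hρ.rational b a) (sortedRoots p) β X ∧ w = X v} := by
  set S := Submodule.span F {w | ∃ X,
      Monomial (fun a b => dividedPower hρ.rational b a) (sortedRoots p) β X ∧ w = X v}
  have hmem : ∀ {β X}, Monomial (fun a b => dividedPower hρ.rational b a) (sortedRoots p) β X →
      X v ∈ weightSpace ρ (lam - β) := by
    intro β X hX
    have := hX.apply_mem_weightSpace (-1) (lowering_mem_weightSpace hρ.rational) hv
    rwa [neg_one_smul, ← sub_eq_add_neg] at this
  have hS : S ≤ weightSpace ρ (lam - β) := by
    rw [Submodule.span_le]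
    rintro _ ⟨X, hX, rfl⟩
    exact hmem hX
  have htop : S ⊔ ⨆ μ, ⨆ (_ : μ ≠ lam - β), weightSpace ρ μ = ⊤ := by
    rw [eq_top_iff, ← hρ.span_monomial_eq_top hp hv h0, Submodule.span_le]
    rintro _ ⟨β', X, hX, rfl⟩
    by_cases hβ : β' = β
    · subst hβ
      exact Submodule.mem_sup_left (Submodule.subset_span ⟨X, hX, rfl⟩)
    · exact Submodule.mem_sup_right (Submodule.mem_iSup_of_mem (lam - β')
        (Submodule.mem_iSup_of_mem (fun h => hβ (sub_right_injective h)) (hmem hX)))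
  intro x hx
  obtain ⟨y, hy, z, hz, rfl⟩ := Submodule.mem_sup.1 (htop ▸ Submodule.mem_top : x ∈ _)
  have hz' : z ∈ weightSpace ρ (lam - β) := by
    simpa using Submodule.sub_mem _ hx (hS hy)
  rw [Submodule.disjoint_def.1 (iSupIndep_weightSpace ρ (lam - β)) z hz' hz, add_zero]
  exact hy

theorem linearMap_ext (hρ : IsSimpleOfHighestWeight ρ lam) {f g : V →ₗ[F] F}
    (h : ∀ μ, ∀ u ∈ weightSpace ρ μ, f u = g u) : f = g := by
  obtain ⟨v, hv, h0⟩ := Submodule.exists_mem_ne_zero_of_ne_bot hρ.weight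
  rcases Nat.eq_zero_or_pos n with rfl | hn
  · exact LinearMap.ext fun u => h lam u fun z => by
      have : torus z = 1 := Subsingleton.elim _ _
      simp [this]
  refine LinearMap.ext_on (hρ.span_monomial_eq_top (p := ⟨n - 1, by omega⟩) (fun a b ha => ?_) hv h0)
    ?_
  · simp only [Fin.lt_def] at ha
    omega
  · rintro _ ⟨β, X, hX, rfl⟩
    exact h _ _ (hX.apply_mem_weightSpace (-1) (lowering_mem_weightSpace hρ.rational) hv)

/-- A vector moved into weight `lam` by a positive divided power would have a weight excluded by
`weightSpace_add_eq_bot`. -/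
theorem functional_rootElt (hρ : IsSimpleOfHighestWeight ρ lam) {φ : V →ₗ[F] F}
    (hφ : IsWeightFunctional ρ lam φ) {a b : Fin n} (hab : b < a ∨ b ≠ a ∧ lam b = lam a) (t : F)
    (u : V) : φ (ρ (rootElt a b t) u) = φ u := by
  have hne : a ≠ b := by
    rcases hab with h | h
    · exact h.ne'
    · exact h.1.symm
  suffices h : φ ∘ₗ ρ (rootElt a b t) = φ from LinearMap.congr_fun h u
  refine hρ.linearMap_ext fun μ u hu => ?_
  rw [LinearMap.comp_apply]
  by_cases hk : ∃ k : ℕ, lam = μ + (k : ℤ) • root a b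
  · obtain ⟨k, hk⟩ := hk
    rw [hφ.apply_rootElt (hr := hρ.rational) hne hk hu]
    rcases Nat.eq_zero_or_pos k with rfl | hk0
    · simp
    · have hμ : μ = lam + (k : ℤ) • root b a := by
        rw [hk, show root b a = -root a b by simp [root]]
        module
      rw [hμ, hρ.weightSpace_add_eq_bot hab hk0, Submodule.mem_bot] at hu
      simp [hu]
  · push Not at hk
    rw [hφ.apply_rootElt_of_forall_ne hρ.rational hk hu, hφ μ _ u hu]
    intro h
    exact hk 0 (by simp [h])

/-- Dual to the spanning statement: `φ` absorbs the lower part and the torus of the big cell, so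
only raising monomials in `w` survive, and for weight reasons only those of weight `β`. -/
theorem eq_zero_of_functional (hρ : IsSimpleOfHighestWeight ρ lam) {p : Fin n}
    (hp : ∀ a b, p < a → p < b → lam a = lam b) {φ : V →ₗ[F] F}
    (hφ : IsWeightFunctional ρ lam φ) (hφ0 : φ ≠ 0) {β : Fin n → ℤ} {w : V}
    (hw : w ∈ weightSpace ρ (lam - β))
    (h : ∀ X, Monomial (dividedPower hρ.rational) (sortedRoots p) β X → φ (X w) = 0) : w = 0 := by
  refine hρ.eq_zero_of_forall hφ0 fun g => ?_
  refine (hρ.rational.isRegularFunction_apply φ w).eq_zero_of_bigCell (List.nodup_finRange n)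
    -- Here rows beyond `p` stand on the left, where `φ` absorbs them.
    (List.mem_finRange) (l' := (List.finRange n).filter (p < ·) ++ (List.finRange n).filter (· ≤ p))
    (l := List.finRange n) List.mem_finRange (fun a => ?_) (fun g z g' hg hg' => ?_) g
  · simp [lt_or_ge]
  · rw [rowPairs_append] at hg'
    obtain ⟨g₁, g₂, hg₁, hg₂, rfl⟩ := hg'.of_append
    have hz : φ ∘ₗ ρ (torus z) = ((∏ a, z a ^ lam a : Fˣ) : F) • φ := by
      refine hρ.linearMap_ext fun μ u hu => ?_
      rw [LinearMap.comp_apply, LinearMap.smul_apply, hu z, map_smul]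
      by_cases hμ : μ = lam
      · rw [hμ]
      · rw [hφ μ hμ u hu, smul_zero, smul_zero]
    have hle : Submodule.span F {u | ∃ β X, Monomial (dividedPower hρ.rational) (sortedRoots p) β X ∧
        u = X w} ≤ LinearMap.ker φ := by
      rw [Submodule.span_le]
      rintro _ ⟨β', X, hX, rfl⟩
      by_cases hβ : β' = β
      · subst hβ
        exact h X hX
      · refine hφ (lam - β + β') (fun heq => hβ ?_) _ ?_
        · rw [sub_add, sub_eq_self, sub_eq_zero] at heq
          exact heq.symm
        · have := hX.apply_mem_weightSpace 1 (raising_mem_weightSpace hρ.rational) hw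
          rwa [one_smul] at this
    rw [map_mul, map_mul, map_mul, Module.End.mul_apply, Module.End.mul_apply, Module.End.mul_apply,
      hg.functional_apply_eq fun r hr t u =>
        hρ.functional_rootElt hφ (Or.inl (mem_rowPairs.1 hr).2.2) t u]
    have := LinearMap.congr_fun hz (ρ g₁ (ρ g₂ w))
    rw [LinearMap.comp_apply] at this
    rw [this, LinearMap.smul_apply, hg₁.functional_apply_eq fun r hr t u => by
      obtain ⟨h1, -, h3⟩ := mem_rowPairs.1 hr
      have h4 : p < r.1 := by simpa using h1
      exact hρ.functional_rootElt hφ (Or.inr ⟨h3.ne', hp _ _ (h4.trans h3) h4⟩) t u]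
    have e3 : φ (ρ g₂ w) = 0 := hle (hg₂.apply_mem_span
      (fun a b u => hasCoeff_dividedPower hρ.rational a b u) w)
    rw [e3, smul_zero]

end IsSimpleOfHighestWeight

end HighestWeight

/-! ### Ranks of matrices and dimensions. -/

section Rank

/-- Transvections diagonalize the matrix over `ZMod p`, and this factorization maps to `F` without
changing which diagonal entries vanish. -/
theorem rank_map_intCast (p : ℕ) [Fact p.Prime] {F : Type*} [Field F] [CharP F p] {ι : Type*}
    [Fintype ι] (A : Matrix ι ι ℤ) : (A.map (Int.cast : ℤ → F)).rank = modRank p A := by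
  classical
  let f : ZMod p →+* F := ZMod.castHom dvd_rfl F
  have hA : A.map (Int.cast : ℤ → F) = (A.map (Int.cast : ℤ → ZMod p)).map f := by
    ext i j
    simp
  rw [hA, modRank]
  obtain ⟨L, L', D, h⟩ := Matrix.Pivot.exists_list_transvec_mul_diagonal_mul_list_transvec
    (A.map (Int.cast : ℤ → ZMod p))
  have hdet : ∀ L : List (Matrix.TransvectionStruct ι (ZMod p)),
      IsUnit ((L.map Matrix.TransvectionStruct.toMatrix).prod).det := fun L => by
    rw [Matrix.TransvectionStruct.det_toMatrix_prod]
    exact isUnit_one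
  have hdet' : ∀ L : List (Matrix.TransvectionStruct ι (ZMod p)),
      IsUnit (((L.map Matrix.TransvectionStruct.toMatrix).prod).map f).det := fun L => by
    have := (hdet L).map f
    rwa [RingHom.map_det] at this
  rw [h, Matrix.map_mul, Matrix.map_mul, Matrix.rank_mul_eq_left_of_isUnit_det _ _ (hdet' L'),
    Matrix.rank_mul_eq_right_of_isUnit_det _ _ (hdet' L),
    Matrix.rank_mul_eq_left_of_isUnit_det _ _ (hdet L'),
    Matrix.rank_mul_eq_right_of_isUnit_det _ _ (hdet L), Matrix.diagonal_map (map_zero f),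
    Matrix.rank_diagonal, Matrix.rank_diagonal]
  exact Fintype.card_congr (Equiv.subtypeEquivRight fun i => by simp)

/-- The dimension of a space spanned by `w b` and separated by functionals `ψ a` is the rank of
the matrix `ψ a (w b)`. -/
theorem finrank_eq_rank {F V : Type*} [Field F] [AddCommGroup V] [Module F V] {ι κ : Type*}
    [Fintype ι] [Fintype κ] {W : Submodule F V} (w : κ → V) (hw : ∀ b, w b ∈ W)
    (hspan : W ≤ Submodule.span F (Set.range w)) (ψ : ι → V →ₗ[F] F)
    (hψ : ∀ u ∈ W, (∀ a, ψ a u = 0) → u = 0) :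
    Module.finrank F W = (Matrix.of fun a b => ψ a (w b)).rank := by
  classical
  let Ψ : W →ₗ[F] (ι → F) := LinearMap.pi fun a => ψ a ∘ₗ W.subtype
  have hinj : Function.Injective Ψ := by
    rw [← LinearMap.ker_eq_bot, LinearMap.ker_eq_bot']
    intro u hu
    exact Subtype.ext (hψ u u.2 fun a => congrFun hu a)
  have hW : Submodule.span F (Set.range fun b => (⟨w b, hw b⟩ : W)) = ⊤ := by
    rw [eq_top_iff]
    rintro ⟨u, hu⟩ -
    have h1 : u ∈ (Submodule.span F (Set.range fun b => (⟨w b, hw b⟩ : W))).map W.subtype := by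
      rw [Submodule.map_span, ← Set.range_comp]
      exact hspan hu
    obtain ⟨u', hu', rfl⟩ := h1
    exact hu'
  rw [← LinearMap.finrank_range_of_inj hinj, Matrix.rank_eq_finrank_span_cols,
    LinearMap.range_eq_map, ← hW, Submodule.map_span, ← Set.range_comp]
  rfl

end Rank

/-! ### Passing between the numbering `1, …, n` and `Fin n`. -/

section Indices

variable {n : ℕ} [NeZero n]

theorem entry_eq (lam : Fin n → ℤ) {a : ℕ} (h1 : 1 ≤ a) (h2 : a ≤ n) :
    entry lam a = lam (toFin n a) := by
  rw [entry, dif_pos ⟨h1, h2⟩]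
  congr 1
  exact Fin.ext (toFin_val h1 h2).symm

theorem toFin_lt {a b : ℕ} (h1 : 1 ≤ a) (h2 : a < b) (h3 : b ≤ n) : toFin n a < toFin n b := by
  rw [Fin.lt_def, toFin_val h1 (by omega), toFin_val (by omega) h3]
  omega

theorem toFin_ne {a b : ℕ} (h : (1 ≤ a ∧ a ≤ n) ∧ (1 ≤ b ∧ b ≤ n) ∧ a ≠ b) :
    toFin n a ≠ toFin n b := by
  rw [Ne, Fin.ext_iff, toFin_val (by omega) (by omega), toFin_val (by omega) (by omega)]
  omega

theorem epsilon_eq {a : ℕ} (h1 : 1 ≤ a) (h2 : a ≤ n) : epsilon n a = Pi.single (toFin n a) 1 := by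
  rw [← epsilon_val_add_one, toFin_val h1 h2, Nat.sub_add_cancel h1]

theorem alpha_eq_root {a b : ℕ} (h1 : 1 ≤ a) (h2 : a ≤ b) (h3 : b ≤ n) :
    alpha n a b = root (toFin n a) (toFin n b) := by
  have : ∀ b, a ≤ b → alpha n a b = epsilon n a - epsilon n b := by
    intro b hb
    induction b, hb using Nat.le_induction with
    | base => simp [alpha]
    | succ b hb ih =>
      rw [alpha, sum_Ico_succ_top hb, ← alpha, ih, simpleRoot]
      abel
  rw [this b h2, epsilon_eq h1 (by omega), epsilon_eq (by omega) h3, root]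

theorem Chain.exists_eq_chainProd {A : Type*} [Monoid A] {y : Fin n → Fin n → ℕ → A} {p i j : ℕ}
    {X : A} (h : Chain y (toFin n p) (toFin n i) (toFin n j) X) {d : ℕ}
    (hd : 1 ≤ i ∧ p = i + 1 + d ∧ p ≤ n ∧ 1 ≤ j ∧ j ≤ n) :
    ∃ B : Idx d, X = chainProd (fun a b k => y (toFin n a) (toFin n b) k) i d B j := by
  have hi := toFin_val (n := n) (a := i) (by omega) (by omega)
  have hp := toFin_val (n := n) (a := p) (by omega) (by omega)
  have hj := toFin_val (n := n) (a := j) (by omega) (by omega)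
  have := h.exists_chainProd d (by omega)
  rwa [hi, hj, Nat.sub_add_cancel hd.1, Nat.sub_add_cancel hd.2.2.2.1] at this

end Indices

/-! ### Dimension of a weight space as the rank of a Gram matrix. -/

section RankFormula

variable {n : ℕ} {F : Type*} [Field F] [Infinite F] {V : Type*} [AddCommGroup V]
  [Module F V] {ρ : Representation F (Matrix.GeneralLinearGroup (Fin n) F) V} {lam : Fin n → ℤ}

/-- The families `f` and `g` need only contain all relevant monomials; repeated or superfluous
members do not affect the rank. -/
theorem IsSimpleOfHighestWeight.finrank_eq_modRank (hρ : IsSimpleOfHighestWeight ρ lam) {p₀ : Fin n}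
    (hp₀ : ∀ a b, p₀ < a → p₀ < b → lam a = lam b) {v : V}
    (hv : v ∈ weightSpace ρ lam) {φ : V →ₗ[F] F} (hφ : IsWeightFunctional ρ lam φ) (h1 : φ v = 1)
    (p : ℕ) [Fact p.Prime] [CharP F p] {β : Fin n → ℤ} {ι : Type*} [Fintype ι]
    (f g : ι → Module.End F V) (hf : ∀ b, f b v ∈ weightSpace ρ (lam - β))
    (hmf : ∀ X, Monomial (fun a b => dividedPower hρ.rational b a) (sortedRoots p₀) β X →
      ∃ b, X = f b)
    (hmg : ∀ X, Monomial (dividedPower hρ.rational) (sortedRoots p₀) β X → ∃ a, X = g a)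
    (A : Matrix ι ι ℤ) (hA : ∀ a b, φ (g a (f b v)) = (A a b : F)) :
    Module.finrank F (weightSpace ρ (lam - β)) = modRank p A := by
  have hv0 : v ≠ 0 := by
    rintro rfl
    simp at h1
  have hφ0 : φ ≠ 0 := by
    rintro rfl
    simp at h1
  rw [← rank_map_intCast p (F := F), finrank_eq_rank (fun b => f b v) hf ?_
    (fun a => φ ∘ₗ g a) fun u hu h => ?_]
  · congr 1
    ext a b
    exact hA a b
  · refine (hρ.weightSpace_le_span hp₀ hv hv0 β).trans (Submodule.span_mono ?_)
    rintro _ ⟨X, hX, rfl⟩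
    obtain ⟨b, rfl⟩ := hmf X hX
    exact ⟨b, rfl⟩
  · refine hρ.eq_zero_of_functional hp₀ hφ hφ0 hu fun X hX => ?_
    obtain ⟨a, rfl⟩ := hmg X hX
    exact h a

end RankFormula

/-! ### The three weight spaces. -/

section HighestWeightOperators

variable {n : ℕ} [NeZero n] {F : Type*} [Field F] [Infinite F] {V : Type*} [AddCommGroup V]
  [Module F V] {ρ : Representation F (Matrix.GeneralLinearGroup (Fin n) F) V} {lam : Fin n → ℤ}

/-- The operators `E_{ab}^{(k)}` with indices numbered `1, …, n`. -/
noncomputable def rootOp (hr : IsRational ρ) (a b k : ℕ) : Module.End F V :=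
  dividedPower hr (toFin n a) (toFin n b) k

theorem rootOp_mem (hr : IsRational ρ) (a b k : ℕ) {μ : Fin n → ℤ} {u : V}
    (hu : u ∈ weightSpace ρ μ) :
    rootOp hr a b k u ∈ weightSpace ρ (μ + (k : ℤ) • root (toFin n a) (toFin n b)) :=
  dividedPower_mem_weightSpace hr hu _ _ k

theorem lowerProd_mem (hr : IsRational ρ) {i d j : ℕ} (B : Idx d) {μ : Fin n → ℤ} {u : V}
    (hu : u ∈ weightSpace ρ μ) :
    lowerProd (rootOp hr) i d B j u ∈ weightSpace ρ (μ + root (toFin n j) (toFin n i)) := by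
  induction d generalizing j μ u with
  | zero =>
    have := rootOp_mem hr j i 1 hu
    rwa [Nat.cast_one, one_smul] at this
  | succ d ih =>
    rcases B with B | B
    · exact ih B hu
    · have := ih (j := i + d + 1) B (rootOp_mem hr j (i + d + 1) 1 hu)
      have h2 : μ + ((1 : ℕ) : ℤ) • root (toFin n j) (toFin n (i + d + 1)) +
          root (toFin n (i + d + 1)) (toFin n i) = μ + root (toFin n j) (toFin n i) := by
        simp [root, add_assoc]
      rwa [h2] at this

namespace IsSimpleOfHighestWeight

theorem isHighestWeightSystem (hρ : IsSimpleOfHighestWeight ρ lam) (hdom : Antitone lam) {v : V}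
    (hv : v ∈ weightSpace ρ lam) {φ : V →ₗ[F] F} (hφ : IsWeightFunctional ρ lam φ) (h1 : φ v = 1) :
    IsHighestWeightSystem n (rootOp hρ.rational) (entry lam) v φ where
  comm h := dividedPower_comm _ (toFin_ne (by omega)) (toFin_ne (by omega)) _ _
  one_mul_one h := dividedPower_one_mul_one _ (toFin_ne (by omega)) (toFin_ne (by omega))
    (toFin_ne (by omega))
  two_mul_one h := dividedPower_two_mul_one _ (toFin_ne (by omega)) (toFin_ne (by omega))
    (toFin_ne (by omega))
  raise h := hρ.dividedPower_eq_zero (Or.inl (toFin_lt h.1 h.2.1 h.2.2)) le_rfl hv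
  lower {a b} h w := by
    -- By invariance of `φ` this polynomial function of `t` is constant, so its linear coefficient
    -- vanishes.
    have h2 := (hasCoeff_dividedPower hρ.rational (toFin n b) (toFin n a) w).map φ
    simp only [hρ.functional_rootElt hφ (Or.inl (toFin_lt h.1 h.2.1 h.2.2))] at h2
    exact congrFun (h2.unique (HasCoeff.const (φ w))) 1
  cartan {a b} h := by
    have hlt := toFin_lt h.1 h.2.1 h.2.2
    have hle := hdom hlt.le
    have := dividedPower_dividedPower_apply hρ.rational hlt.ne hv
      (fun t => hρ.apply_rootElt (Or.inl hlt) hv t) (j := 0)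
      (m := (lam (toFin n a) - lam (toFin n b)).toNat) (by simp; omega) 1
    rw [entry_eq lam h.1 (by omega), entry_eq lam (by omega) h.2.2]
    simp only [Nat.add_zero, dividedPower_zero, Module.End.one_apply,
      Nat.choose_one_right] at this
    refine this.trans ?_
    congr 1
    rw [← Int.cast_natCast, Int.toNat_of_nonneg (by omega)]
  norm := h1

end IsSimpleOfHighestWeight

/-- The weight space of `lam - α(i, j)`. -/
theorem IsSimpleOfHighestWeight.finrank_matX (hρ : IsSimpleOfHighestWeight ρ lam)
    (hdom : Antitone lam) {p₀ : Fin n} (hp₀ : ∀ a b, p₀ < a → p₀ < b → lam a = lam b) {v : V}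
    (hv : v ∈ weightSpace ρ lam) {φ : V →ₗ[F] F} (hφ : IsWeightFunctional ρ lam φ) (h1 : φ v = 1)
    (p : ℕ) [Fact p.Prime] [CharP F p] {i j : ℕ} (hi : 1 ≤ i) (hij : i < j) (hj : j ≤ n) :
    Module.finrank F (weightSpace ρ (lam - alpha n i j)) = modRank p (matX lam i j i i) := by
  have S := hρ.isHighestWeightSystem hdom hv hφ h1
  rw [alpha_eq_root hi hij.le hj]
  refine hρ.finrank_eq_modRank hp₀ hv hφ h1 p
    (fun B => lowerProd (rootOp hρ.rational) i (j - 1 - i) B j)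
    (fun B => upperProd (rootOp hρ.rational) i (j - 1 - i) B j) (fun B => ?_) (fun X hX => ?_)
    (fun X hX => ?_) _ (fun A B => ?_)
  · have := lowerProd_mem hρ.rational (i := i) (j := j) B hv
    rwa [show root (toFin n j) (toFin n i) = -root (toFin n i) (toFin n j) by simp [root],
      ← sub_eq_add_neg] at this
  · exact (hX.chain (by simp) (toFin_lt hi hij hj) (isSortedRoots_sortedRoots _)).exists_eq_chainProd
      (by omega)
  · exact (hX.chain (by simp) (toFin_lt hi hij hj) (isSortedRoots_sortedRoots _)).exists_eq_chainProd
      (by omega)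
  · rw [S.pairing A B (by omega), matX, (matXY_eq_gram lam i j (j - 1 - i)).1]

namespace IsSimpleOfHighestWeight

theorem rootOp_one_eq_zero (hρ : IsSimpleOfHighestWeight ρ lam) {v : V}
    (hv : v ∈ weightSpace ρ lam) {q r : ℕ} (h : (1 ≤ q ∧ q ≤ n) ∧ (1 ≤ r ∧ r ≤ n) ∧ q ≠ r)
    (hqr : entry lam q = entry lam r) : rootOp hρ.rational q r 1 v = 0 := by
  rw [entry_eq lam h.1.1 h.1.2, entry_eq lam h.2.1.1 h.2.1.2] at hqr
  exact hρ.dividedPower_eq_zero (Or.inr ⟨toFin_ne h, hqr⟩) le_rfl hv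

/-- The vector `E_qs v` is fixed by the root subgroup of `(s, r)`, so it behaves as an `SL_2`
highest weight vector, of weight `λ_s - 1`. -/
theorem rootOp_apply_rootOp_pair (hρ : IsSimpleOfHighestWeight ρ lam) {v : V}
    (hv : v ∈ weightSpace ρ lam) {s q r : ℕ}
    (h : 1 ≤ s ∧ s < q ∧ q ≤ n ∧ s < r ∧ r ≤ n ∧ q ≠ r) (hq : entry lam q = 0)
    (hr : entry lam r = 0) (hs : 1 ≤ entry lam s) :
    rootOp hρ.rational s r 1 (rootOp hρ.rational r s 1 (rootOp hρ.rational q s 1 v)) =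
      ((entry lam s - 1 : ℤ) : F) • rootOp hρ.rational q s 1 v := by
  have hsr := toFin_lt h.1 h.2.2.2.1 h.2.2.2.2.1
  have hsq := toFin_lt h.1 h.2.1 h.2.2.1
  have hqr : toFin n q ≠ toFin n r := toFin_ne (by omega)
  rw [entry_eq lam (by omega) (by omega)] at hq hr hs ⊢
  have hw := rootOp_mem hρ.rational q s 1 hv
  rw [Nat.cast_one, one_smul] at hw
  have hfix : ∀ t, ρ (rootElt (toFin n s) (toFin n r) t) (rootOp hρ.rational q s 1 v) =
      rootOp hρ.rational q s 1 v := by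
    refine apply_rootElt_eq (hr := hρ.rational) fun k hk => ?_
    have h1 := dividedPower_mem_weightSpace hρ.rational hw (toFin n s) (toFin n r) k
    rw [← Submodule.mem_bot F]
    convert h1
    symm
    -- For `k = 1` the weight is `lam + root q r`, excluded because `lam` agrees at `q` and `r`; for
    -- `k ≥ 2` the partial sum up to `s` exceeds that of `lam`.
    rcases hk.eq_or_lt with rfl | hk
    · have := hρ.weightSpace_add_eq_bot (a := toFin n q) (b := toFin n r)
        (Or.inr ⟨hqr, by rw [hq, hr]⟩) le_rfl
      rw [← this]
      congr 1
      simp [root, add_assoc]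
    · by_contra hne
      have h2 := (hρ.highest _ hne).sum_le (toFin n s)
      simp only [Pi.add_apply, Pi.smul_apply, sum_add_distrib, ← smul_sum, sum_Iic_root,
        if_neg hsq.not_ge, if_neg hsr.not_ge] at h2
      simp at h2
      omega
  have := dividedPower_dividedPower_apply hρ.rational hsr.ne hw hfix (j := 0)
    (m := (lam (toFin n s) - 1).toNat) (by
      simp [root_apply, hsr.ne', hsq.ne, hqr.symm, hr]
      omega) 1
  simp only [Nat.add_zero, dividedPower_zero, Module.End.one_apply, Nat.choose_one_right] at this
  refine this.trans ?_
  congr 1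
  rw [← Int.cast_natCast, Int.toNat_of_nonneg (by omega)]

theorem rootOp_apply_rootOp_square (hρ : IsSimpleOfHighestWeight ρ lam) {v : V}
    (hv : v ∈ weightSpace ρ lam) {s q : ℕ} (h : 1 ≤ s ∧ s < q ∧ q ≤ n) (hq : entry lam q = 0)
    (hs : 1 ≤ entry lam s) :
    rootOp hρ.rational s q 1 (rootOp hρ.rational q s 1 v) = ((entry lam s : ℤ) : F) • v ∧
    rootOp hρ.rational s q 1 (rootOp hρ.rational q s 2 v) =
      ((entry lam s - 1 : ℤ) : F) • rootOp hρ.rational q s 1 v ∧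
    rootOp hρ.rational s q 2 (rootOp hρ.rational q s 1 v) = 0 ∧
    rootOp hρ.rational s q 2 (rootOp hρ.rational q s 2 v) =
      ((entry lam s * (entry lam s - 1) / 2 : ℤ) : F) • v := by
  have hsq := toFin_lt h.1 h.2.1 h.2.2
  rw [entry_eq lam (by omega) (by omega)] at hq hs ⊢
  obtain ⟨l, hl⟩ := Int.eq_ofNat_of_zero_le (a := lam (toFin n s)) (by omega)
  have key := fun j m hm => dividedPower_dividedPower_apply hρ.rational hsq.ne hv
    (fun t => hρ.apply_rootElt (Or.inl hsq) hv t) (j := j) (m := m) hm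
  have k0 := key 0 l (by rw [hl, hq]; simp)
  have k1 := key 1 (l - 1) (by rw [hl, hq]; omega) 1
  simp only [Nat.add_zero, dividedPower_zero, Module.End.one_apply] at k0
  rw [Nat.choose_one_right] at k1
  rw [hl]
  refine ⟨?_, ?_, ?_, ?_⟩
  · refine (k0 1).trans ?_
    rw [Nat.choose_one_right, Int.cast_natCast]
  · refine k1.trans ?_
    congr 1
    rw [← Int.cast_natCast, Nat.cast_sub (by omega), Nat.cast_one]
  · have h1 := rootOp_mem hρ.rational s q 2 (rootOp_mem hρ.rational q s 1 hv)
    have h2 := hρ.weightSpace_add_eq_bot (Or.inl hsq) (k := 1) le_rfl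
    rw [← Submodule.mem_bot F, ← h2]
    refine Eq.subst (motive := fun μ => _ ∈ weightSpace ρ μ) ?_ h1
    simp only [root, Nat.cast_one, Nat.cast_ofNat, one_smul, two_smul]
    abel
  · refine (k0 2).trans ?_
    congr 1
    rw [← Int.cast_natCast, Nat.choose_two_right, Int.natCast_div, Nat.cast_mul,
      Nat.cast_sub (by omega), Nat.cast_one, Nat.cast_ofNat]

end IsSimpleOfHighestWeight

/-- The weight space of `lam - α(i, s + 1) - α(s, s + 2)`. -/
theorem IsSimpleOfHighestWeight.finrank_matM (hρ : IsSimpleOfHighestWeight ρ lam)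
    (hdom : Antitone lam) {s : ℕ}
    (hp₀ : ∀ a b, toFin n s < a → toFin n s < b → lam a = lam b) {v : V}
    (hv : v ∈ weightSpace ρ lam) {φ : V →ₗ[F] F} (hφ : IsWeightFunctional ρ lam φ) (h1 : φ v = 1)
    (p : ℕ) [Fact p.Prime] [CharP F p] {i : ℕ} (hi : 1 ≤ i) (his : i < s) (hsn : s + 2 ≤ n)
    (hs : 1 ≤ entry lam s) (hs1 : entry lam (s + 1) = 0) (hs2 : entry lam (s + 2) = 0) :
    Module.finrank F (weightSpace ρ (lam - alpha n i (s + 1) - alpha n s (s + 2))) =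
      modRank p (matM lam s i) := by
  have S := hρ.isHighestWeightSystem hdom hv hφ h1
  rw [alpha_eq_root hi (by omega) (by omega), alpha_eq_root (by omega) (by omega) hsn, sub_sub]
  set e := rootOp hρ.rational with he
  have hcommL : e (s + 1) s 1 * e (s + 2) s 1 = e (s + 2) s 1 * e (s + 1) s 1 :=
    (S.comm (by omega)).eq
  have hcommU : e s (s + 1) 1 * e s (s + 2) 1 = e s (s + 2) 1 * e s (s + 1) 1 :=
    (S.comm (by omega)).eq
  have hlt1 := toFin_lt (n := n) hi his (by omega)
  have hlt2 := toFin_lt (n := n) (a := s) (b := s + 1) (by omega) (by omega) (by omega)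
  have hlt3 := toFin_lt (n := n) (a := s) (b := s + 2) (by omega) (by omega) (by omega)
  have hne : toFin n (s + 1) ≠ toFin n (s + 2) := toFin_ne (by omega)
  refine hρ.finrank_eq_modRank hp₀ hv hφ h1 p
    (fun b : Fin 3 × Idx (s + 1 - 1 - (i + 1)) =>
      ![lowerProd e i _ b.2 (s + 1) * e (s + 2) s 1, lowerProd e i _ b.2 (s + 2) * e (s + 1) s 1,
        lowerProd e i _ b.2 s * (e (s + 1) s 1 * e (s + 2) s 1)] b.1)
    (fun a : Fin 3 × Idx (s + 1 - 1 - (i + 1)) =>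
      ![upperProd e i _ a.2 (s + 1) * e s (s + 2) 1, upperProd e i _ a.2 (s + 2) * e s (s + 1) 1,
        upperProd e i _ a.2 s * (e s (s + 1) 1 * e s (s + 2) 1)] a.1)
    (fun b => ?_) (fun X hX => ?_) (fun X hX => ?_) _ (fun a b => ?_)
  · obtain ⟨b, B⟩ := b
    have m1 : ∀ q, e q s 1 v ∈ weightSpace ρ (lam + root (toFin n q) (toFin n s)) := fun q => by
      simpa using rootOp_mem hρ.rational q s 1 hv
    have mem : ∀ {μ u}, u ∈ weightSpace ρ μ → μ = lam - (root (toFin n i) (toFin n (s + 1)) +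
        root (toFin n s) (toFin n (s + 2))) → u ∈ weightSpace ρ (lam -
          (root (toFin n i) (toFin n (s + 1)) + root (toFin n s) (toFin n (s + 2)))) :=
      fun h h' => h' ▸ h
    fin_cases b
    · refine mem (lowerProd_mem hρ.rational (i := i) (j := s + 1) B (m1 (s + 2))) ?_
      simp only [root]
      abel
    · refine mem (lowerProd_mem hρ.rational (i := i) (j := s + 2) B (m1 (s + 1))) ?_
      simp only [root]
      abel
    · refine mem (lowerProd_mem hρ.rational (i := i) (j := s) B
        (rootOp_mem hρ.rational (s + 1) s 1 (m1 (s + 2)))) ?_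
      simp only [root, Nat.cast_one, one_smul]
      abel
  · rcases hX.chain_mul (by simp) hlt1 hlt2 hlt3 hne (isSortedRoots_sortedRoots _)
      fst_le_of_mem_sortedRoots with ⟨Z, hZ, rfl⟩ | ⟨Z, hZ, rfl⟩ | ⟨Z, hZ, hX⟩ <;>
    obtain ⟨B, rfl⟩ := hZ.exists_eq_chainProd (d := s + 1 - 1 - (i + 1)) (by omega)
    · exact ⟨(0, B), rfl⟩
    · exact ⟨(1, B), rfl⟩
    · refine ⟨(2, B), ?_⟩
      rcases hX with rfl | rfl
      · rfl
      · exact congrArg _ hcommL.symm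
  · rcases hX.chain_mul (by simp) hlt1 hlt2 hlt3 hne (isSortedRoots_sortedRoots _)
      fst_le_of_mem_sortedRoots with ⟨Z, hZ, rfl⟩ | ⟨Z, hZ, rfl⟩ | ⟨Z, hZ, hX⟩ <;>
    obtain ⟨B, rfl⟩ := hZ.exists_eq_chainProd (d := s + 1 - 1 - (i + 1)) (by omega)
    · exact ⟨(0, B), rfl⟩
    · exact ⟨(1, B), rfl⟩
    · refine ⟨(2, B), ?_⟩
      rcases hX with rfl | rfl
      · rfl
      · exact congrArg _ hcommU.symm
  · obtain ⟨a, A⟩ := a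
    obtain ⟨b, B⟩ := b
    have k1 : e (s + 1) (s + 2) 1 v = 0 := hρ.rootOp_one_eq_zero hv (by omega) (by rw [hs1, hs2])
    have k2 : e (s + 2) (s + 1) 1 v = 0 := hρ.rootOp_one_eq_zero hv (by omega) (by rw [hs1, hs2])
    have k3 := hρ.rootOp_apply_rootOp_pair hv (s := s) (q := s + 1) (r := s + 2) (by omega) hs1 hs2 hs
    have k4 := hρ.rootOp_apply_rootOp_pair hv (s := s) (q := s + 2) (r := s + 1) (by omega) hs2 hs1 hs
    have hL : ∀ u, e (s + 1) s 1 (e (s + 2) s 1 u) = e (s + 2) s 1 (e (s + 1) s 1 u) := fun u =>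
      LinearMap.congr_fun hcommL u
    have hU : ∀ u, e s (s + 1) 1 (e s (s + 2) 1 u) = e s (s + 2) 1 (e s (s + 1) 1 u) := fun u =>
      LinearMap.congr_fun hcommU u
    have a1 := S.apply_lowerProd_single (i := i) (p := s) (q := s + 1) (r := s + 2) B (by omega)
    have a2 := S.apply_lowerProd_single (i := i) (p := s) (q := s + 2) (r := s + 1) B (by omega)
    have b1 := S.apply_lowerProd_other (i := i) (p := s) (q := s + 1) (r := s + 2) B (by omega) k1
    have b2 := S.apply_lowerProd_other (i := i) (p := s) (q := s + 2) (r := s + 1) B (by omega) k2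
    have c1 := S.apply_lowerProd_pair (i := i) (p := s) (q := s + 1) (r := s + 2) B (by omega) k3
    have c2 := S.apply_lowerProd_pair (i := i) (p := s) (q := s + 2) (r := s + 1) B (by omega) k4
    have c3 : e s (s + 1) 1 (lowerProd e i _ B s (e (s + 1) s 1 v)) =
        ((entry lam s - entry lam (s + 1) : ℤ) : F) • lowerProd e i _ B s v := by
      rw [← Module.End.mul_apply (e s (s + 1) 1), ← (S.commute_lowerProd B (by omega)).eq,
        Module.End.mul_apply, S.cartan (by omega), map_smul]
    have d1 := S.apply_lowerProd (i := i) (c := s) (j := s + 1) B (by omega)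
    have d2 := S.apply_lowerProd (i := i) (c := s) (j := s + 2) B (by omega)
    have p0 := S.pairing (i := i) (j := s) A B (by omega)
    have p1 := S.pairing (i := i) (j := s + 1) A B (by omega)
    have p2 := S.pairing (i := i) (j := s + 2) A B (by omega)
    have q1 := S.pairing_swap (i := i) (c := s) (j := s + 1) A B (by omega)
    have q2 := S.pairing_swap (i := i) (c := s) (j := s + 2) A B (by omega)
    have x1 := (matXY_eq_gram lam i (s + 1) (s + 1 - 1 - (i + 1))).1
    have x2 := (matXY_eq_gram lam i (s + 1) (s + 1 - 1 - (i + 1))).2 s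
    -- As `λ_{s+1} = λ_{s+2} = 0`, chains ending at `s + 1` and at `s + 2` have the same Gram matrix
    -- `X`, while chains ending at `s` have `X + Y`.
    simp only [hs1, hs2, sub_zero] at a1 a2 c3 p1 p2 x1 x2
    simp only [p0, p1, p2] at q1 q2
    simp only [matM, matX, matY, x1, x2, add_sub_cancel]
    fin_cases a <;> fin_cases b
    · change φ (upperProd e i _ A (s + 1) (e s (s + 2) 1 (lowerProd e i _ B (s + 1)
        (e (s + 2) s 1 v)))) = ((entry lam s * gram (entry lam) i _ 0 A B : ℤ) : F)
      rw [a1, map_smul, map_smul, p1, smul_eq_mul, Int.cast_mul]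
    · change φ (upperProd e i _ A (s + 1) (e s (s + 2) 1 (lowerProd e i _ B (s + 2)
        (e (s + 1) s 1 v)))) = ((gram (entry lam) i _ (entry lam s) A B -
          gram (entry lam) i _ 0 A B : ℤ) : F)
      rw [b1, q1, Int.cast_sub]
    · change φ (upperProd e i _ A (s + 1) (e s (s + 2) 1 (lowerProd e i _ B s
        (e (s + 1) s 1 (e (s + 2) s 1 v))))) = (((entry lam s - 1) *
          (gram (entry lam) i _ (entry lam s) A B - gram (entry lam) i _ 0 A B) : ℤ) : F)
      rw [c1, map_smul, map_smul, q1, smul_eq_mul, Int.cast_mul, Int.cast_sub (gram _ _ _ _ _ _)]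
    · change φ (upperProd e i _ A (s + 2) (e s (s + 1) 1 (lowerProd e i _ B (s + 1)
        (e (s + 2) s 1 v)))) = ((gram (entry lam) i _ (entry lam s) A B -
          gram (entry lam) i _ 0 A B : ℤ) : F)
      rw [b2, q2, Int.cast_sub]
    · change φ (upperProd e i _ A (s + 2) (e s (s + 1) 1 (lowerProd e i _ B (s + 2)
        (e (s + 1) s 1 v)))) = ((entry lam s * gram (entry lam) i _ 0 A B : ℤ) : F)
      rw [a2, map_smul, map_smul, p2, smul_eq_mul, Int.cast_mul]
    · change φ (upperProd e i _ A (s + 2) (e s (s + 1) 1 (lowerProd e i _ B s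
        (e (s + 1) s 1 (e (s + 2) s 1 v))))) = (((entry lam s - 1) *
          (gram (entry lam) i _ (entry lam s) A B - gram (entry lam) i _ 0 A B) : ℤ) : F)
      rw [hL, c2, map_smul, map_smul, q2, smul_eq_mul, Int.cast_mul,
        Int.cast_sub (gram _ _ _ _ _ _)]
    · change φ (upperProd e i _ A s (e s (s + 1) 1 (e s (s + 2) 1 (lowerProd e i _ B (s + 1)
        (e (s + 2) s 1 v))))) = ((entry lam s * gram (entry lam) i _ (entry lam s) A B : ℤ) : F)
      rw [a1, map_smul, map_smul, map_smul, d1, p0, smul_eq_mul, Int.cast_mul]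
    · change φ (upperProd e i _ A s (e s (s + 1) 1 (e s (s + 2) 1 (lowerProd e i _ B (s + 2)
        (e (s + 1) s 1 v))))) = ((entry lam s * gram (entry lam) i _ (entry lam s) A B : ℤ) : F)
      rw [hU, a2, map_smul, map_smul, map_smul, d2, p0, smul_eq_mul, Int.cast_mul]
    · change φ (upperProd e i _ A s (e s (s + 1) 1 (e s (s + 2) 1 (lowerProd e i _ B s
        (e (s + 1) s 1 (e (s + 2) s 1 v)))))) =
          ((entry lam s * (entry lam s - 1) * gram (entry lam) i _ (entry lam s) A B : ℤ) : F)
      rw [c1, map_smul, map_smul, map_smul, c3, map_smul, map_smul, p0, smul_eq_mul, smul_eq_mul,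
        Int.cast_mul, Int.cast_mul]
      ring

/-- The weight space of `lam - α(i, s + 1) - α(s, s + 1)`. -/
theorem IsSimpleOfHighestWeight.finrank_matW (hρ : IsSimpleOfHighestWeight ρ lam)
    (hdom : Antitone lam) {s : ℕ}
    (hp₀ : ∀ a b, toFin n s < a → toFin n s < b → lam a = lam b) {v : V}
    (hv : v ∈ weightSpace ρ lam) {φ : V →ₗ[F] F} (hφ : IsWeightFunctional ρ lam φ) (h1 : φ v = 1)
    (p : ℕ) [Fact p.Prime] [CharP F p] {i : ℕ} (hi : 1 ≤ i) (his : i < s) (hsn : s + 1 ≤ n)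
    (hs : 1 ≤ entry lam s) (hs1 : entry lam (s + 1) = 0) :
    Module.finrank F (weightSpace ρ (lam - alpha n i (s + 1) - alpha n s (s + 1))) =
      modRank p (matW lam s i) := by
  have S := hρ.isHighestWeightSystem hdom hv hφ h1
  rw [alpha_eq_root hi (by omega) (by omega), alpha_eq_root (by omega) (by omega) hsn, sub_sub]
  set e := rootOp hρ.rational with he
  have hlt1 := toFin_lt (n := n) hi his (by omega)
  have hlt2 := toFin_lt (n := n) (a := s) (b := s + 1) (by omega) (by omega) (by omega)
  refine hρ.finrank_eq_modRank hp₀ hv hφ h1 p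
    (fun b : Fin 2 × Idx (s + 1 - 1 - (i + 1)) =>
      ![lowerProd e i _ b.2 (s + 1) * e (s + 1) s 1, lowerProd e i _ b.2 s * e (s + 1) s 2] b.1)
    (fun a : Fin 2 × Idx (s + 1 - 1 - (i + 1)) =>
      ![upperProd e i _ a.2 (s + 1) * e s (s + 1) 1, upperProd e i _ a.2 s * e s (s + 1) 2] a.1)
    (fun b => ?_) (fun X hX => ?_) (fun X hX => ?_) _ (fun a b => ?_)
  · obtain ⟨b, B⟩ := b
    have mem : ∀ {μ u}, u ∈ weightSpace ρ μ → μ = lam - (root (toFin n i) (toFin n (s + 1)) +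
        root (toFin n s) (toFin n (s + 1))) → u ∈ weightSpace ρ (lam -
          (root (toFin n i) (toFin n (s + 1)) + root (toFin n s) (toFin n (s + 1)))) :=
      fun h h' => h' ▸ h
    fin_cases b
    · refine mem (lowerProd_mem hρ.rational (i := i) (j := s + 1) B
        (rootOp_mem hρ.rational (s + 1) s 1 hv)) ?_
      simp only [root, Nat.cast_one, one_smul]
      abel
    · refine mem (lowerProd_mem hρ.rational (i := i) (j := s) B
        (rootOp_mem hρ.rational (s + 1) s 2 hv)) ?_
      simp only [root, Nat.cast_ofNat, two_smul]
      abel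
  · rcases hX.chain_mul_square (by simp) hlt1 hlt2 (isSortedRoots_sortedRoots _)
      fst_le_of_mem_sortedRoots (nodup_sortedRoots _) with ⟨Z, hZ, rfl⟩ | ⟨Z, hZ, rfl⟩ <;>
    obtain ⟨B, rfl⟩ := hZ.exists_eq_chainProd (d := s + 1 - 1 - (i + 1)) (by omega)
    · exact ⟨(0, B), rfl⟩
    · exact ⟨(1, B), rfl⟩
  · rcases hX.chain_mul_square (by simp) hlt1 hlt2 (isSortedRoots_sortedRoots _)
      fst_le_of_mem_sortedRoots (nodup_sortedRoots _) with ⟨Z, hZ, rfl⟩ | ⟨Z, hZ, rfl⟩ <;>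
    obtain ⟨B, rfl⟩ := hZ.exists_eq_chainProd (d := s + 1 - 1 - (i + 1)) (by omega)
    · exact ⟨(0, B), rfl⟩
    · exact ⟨(1, B), rfl⟩
  · obtain ⟨a, A⟩ := a
    obtain ⟨b, B⟩ := b
    obtain ⟨k11, k12, k21, k22⟩ := hρ.rootOp_apply_rootOp_square hv (s := s) (q := s + 1)
      (by omega) hs1 hs
    have c0 := (S.commute_lowerProd (i := i) (b := s) (u := s) (w := s + 1) (k := 1) B
      (by omega)).eq
    have c1 := (S.commute_lowerProd (i := i) (b := s) (u := s) (w := s + 1) (k := 2) B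
      (by omega)).eq
    have m1 := S.mul_lowerProd (i := i) (c := s) (j := s + 1) B (by omega)
    have m2 := S.two_mul_lowerProd (i := i) (c := s) (j := s + 1) B (by omega)
    have p0 := S.pairing (i := i) (j := s) A B (by omega)
    have p1 := S.pairing (i := i) (j := s + 1) A B (by omega)
    have q1 := S.pairing_swap (i := i) (c := s) (j := s + 1) A B (by omega)
    have x1 := (matXY_eq_gram lam i (s + 1) (s + 1 - 1 - (i + 1))).1
    have x2 := (matXY_eq_gram lam i (s + 1) (s + 1 - 1 - (i + 1))).2 s
    simp only [hs1] at p1 x1 x2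
    simp only [p0, p1] at q1
    simp only [matW, matX, matY, x1, x2, add_sub_cancel]
    fin_cases a <;> fin_cases b
    · change φ (upperProd e i _ A (s + 1) (e s (s + 1) 1 (lowerProd e i _ B (s + 1)
        (e (s + 1) s 1 v)))) = ((entry lam s * gram (entry lam) i _ 0 A B +
          (gram (entry lam) i _ (entry lam s) A B - gram (entry lam) i _ 0 A B) : ℤ) : F)
      -- The raising operator meets both the last link of the chain and the extra factor, giving the
      -- two summands `Y` and `λ_s X`.
      rw [← Module.End.mul_apply (e s (s + 1) 1), m1, LinearMap.add_apply, Module.End.mul_apply,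
        k11, map_smul, map_add, map_add, map_smul, map_smul, p1, q1, smul_eq_mul, Int.cast_add,
        Int.cast_mul, Int.cast_sub]
    · change φ (upperProd e i _ A (s + 1) (e s (s + 1) 1 (lowerProd e i _ B s
        (e (s + 1) s 2 v)))) = (((entry lam s - 1) *
          (gram (entry lam) i _ (entry lam s) A B - gram (entry lam) i _ 0 A B) : ℤ) : F)
      rw [← Module.End.mul_apply (e s (s + 1) 1), ← c0, Module.End.mul_apply, k12, map_smul,
        map_smul, map_smul, q1, smul_eq_mul, Int.cast_mul, Int.cast_sub (gram _ _ _ _ _ _)]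
    · change φ (upperProd e i _ A s (e s (s + 1) 2 (lowerProd e i _ B (s + 1)
        (e (s + 1) s 1 v)))) = ((entry lam s * gram (entry lam) i _ (entry lam s) A B : ℤ) : F)
      rw [← Module.End.mul_apply (e s (s + 1) 2), m2, LinearMap.add_apply, Module.End.mul_apply,
        Module.End.mul_apply, k21, k11, map_zero, zero_add, map_smul, map_smul, map_smul, p0,
        smul_eq_mul, Int.cast_mul]
    · change φ (upperProd e i _ A s (e s (s + 1) 2 (lowerProd e i _ B s
        (e (s + 1) s 2 v)))) = ((entry lam s * (entry lam s - 1) / 2 *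
          gram (entry lam) i _ (entry lam s) A B : ℤ) : F)
      rw [← Module.End.mul_apply (e s (s + 1) 2), ← c1, Module.End.mul_apply, k22, map_smul,
        map_smul, map_smul, p0, smul_eq_mul, Int.cast_mul]

end HighestWeightOperators

end GLWeights

/-! ### The theorem. -/

theorem theorem4 (p : ℕ) [Fact p.Prime] {F : Type*} [Field F] [IsAlgClosed F] [CharP F p]
    {n : ℕ} (lam : Fin n → ℤ) (hdom : Antitone lam)
    (s : ℕ) (hs1 : 1 ≤ s) (hsn : s < n - 1)
    (hs : GLWeights.entry lam s ≠ 0)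
    (hlast : ∀ a : ℕ, s < a → a ≤ n → GLWeights.entry lam a = 0)
    {V : Type*} [AddCommGroup V] [Module F V]
    (ρ : Representation F (Matrix.GeneralLinearGroup (Fin n) F) V)
    (hρ : GLWeights.IsSimpleOfHighestWeight ρ lam) :
    (∀ i j : ℕ, 1 ≤ i → i < j → j ≤ n →
      Module.finrank F (GLWeights.weightSpace ρ (lam - GLWeights.alpha n i j)) =
        GLWeights.modRank p (GLWeights.matX lam i j i i)) ∧
    (∀ i : ℕ, 1 ≤ i → i < s →
      Module.finrank F (GLWeights.weightSpace ρ
          (lam - GLWeights.alpha n i (s + 1) - GLWeights.alpha n s (s + 2))) =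
        GLWeights.modRank p (GLWeights.matM lam s i)) ∧
    (∀ i : ℕ, 1 ≤ i → i < s →
      Module.finrank F (GLWeights.weightSpace ρ
          (lam - GLWeights.alpha n i (s + 1) - GLWeights.alpha n s (s + 1))) =
        GLWeights.modRank p (GLWeights.matW lam s i)) := by
  have hn : NeZero n := ⟨by omega⟩
  have hinf : Infinite F := IsAlgClosed.instInfinite
  obtain ⟨v, hv, h0⟩ := Submodule.exists_mem_ne_zero_of_ne_bot hρ.weight
  obtain ⟨φ, hφ, h1⟩ := GLWeights.exists_isWeightFunctional hv h0
  have hzero : ∀ a, GLWeights.toFin n s < a → lam a = 0 := fun a ha => by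
    have h2 := hlast (a.val + 1) (by
      rw [Fin.lt_def, GLWeights.toFin_val hs1 (by omega)] at ha
      omega) (by omega)
    rwa [GLWeights.entry_eq lam (by omega) (by omega), GLWeights.toFin_val_add_one] at h2
  have hp₀ : ∀ a b, GLWeights.toFin n s < a → GLWeights.toFin n s < b → lam a = lam b :=
    fun a b ha hb => by rw [hzero a ha, hzero b hb]
  have hpos : 1 ≤ GLWeights.entry lam s := by
    have h2 := hdom (GLWeights.toFin_lt (n := n) hs1 (Nat.lt_succ_self s) (by omega)).le
    rw [← GLWeights.entry_eq lam (by omega) (by omega), ← GLWeights.entry_eq lam hs1 (by omega),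
      hlast (s + 1) (by omega) (by omega)] at h2
    omega
  exact ⟨fun i j hi hij hj => hρ.finrank_matX hdom hp₀ hv hφ h1 p hi hij hj,
    fun i hi his => hρ.finrank_matM hdom hp₀ hv hφ h1 p hi his (by omega) hpos
      (hlast _ (by omega) (by omega)) (hlast _ (by omega) (by omega)),
    fun i hi his => hρ.finrank_matW hdom hp₀ hv hφ h1 p hi his (by omega) hpos
      (hlast _ (by omega) (by omega))⟩
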